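/- Let $V$ be a finite set and let $\mu$ be a probability distribution on $\{-1,+1\}^V$ with support $\Omega(\mu)$. For $\Lambda\subseteq V$ let $\mu_\Lambda$ be the marginal of $\mu$ on $\Lambda$ (write $\mu_v=\mu_{\{v\}}$), and for $\sigma_\Lambda\in\Omega(\mu_\Lambda)$ let $\mu^{\sigma_\Lambda}$ be the distribution on $\{-1,+1\}^V$ obtained by conditioning $\mu$ on the configuration on $\Lambda$ being $\sigma_\Lambda$. *Spectral independence.* For $\Lambda\subseteq V$ and $\sigma_\Lambda\in\Omega(\mu_\Lambda)$, the influence matrix $\Psi_\mu^{\sigma_\Lambda}\in\mathbb{R}_{\ge 0}^{(V\setminus\Lambda)\times(V\setminus\Lambda)}$ has zero diagonal and, for distinct $u,v\in V\setminus\Lambda$, $$\Psi_\mu^{\sigma_\Lambda}(u,v)=\max_{c,c'\in\Omega(\mu_u^{\sigma_\Lambda})} d_{\mathrm{TV}}\bigl(\mu_v^{\sigma_\Lambda,u\leftarrow c},\,\mu_v^{\sigma_\Lambda,u\leftarrow c'}\bigr),$$ where $\mu_v^{\sigma_\Lambda,u\leftarrow c}$ is the marginal at $v$ of $\mu^{\sigma_\Lambda}$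 further conditioned on $u$ taking the value $c$, and $d_{\mathrm{TV}}$ is total variation distance. For $\eta>0$, $\mu$ is $\eta$-spectrally independent if the spectral radius of $\Psi_\mu^{\sigma_\Lambda}$ is at most $\eta$ for all $\Lambda\subseteq V$ and all $\sigma_\Lambda\in\Omega(\mu_\Lambda)$. *Local fields.* For $\phi\in(0,\infty)^V$ let $\mu^{(\phi)}$ be the distribution on $\{-1,+1\}^V$ with $\mu^{(\phi)}(\sigma)\propto\mu(\sigma)\prod_{v\in V:\,\sigma_v=+1}\phi_v$; for a scalar $\theta>0$ write $\mu^{(\theta)}$ for the case $\phi_v=\theta$ for all $v$. The distribution $\mu$ is completely $\eta$-spectrally independent if $\mu^{(\phi)}$ is $\eta$-spectrally independent for every $\phi\in(0,1]^V$. *Glauber gap.* The Glauber dynamics for $\mu$ is the Markov chain on $\Omega(\mu)$ that in each step picks $v\in V$ uniformly at random and resamples the value at $v$ from $\mu$ conditioned on the current configuration on $V\setminus\{v\}$. Its transition matrix has real eigenvalues $1=\lambda_1\ge\lambda_2\ge\cdots$, and $\mathrm{gap}_{\mathrm{GD}}(\mu)=1-\lambda_2$, with the convention $\mathrm{gap}_{\mathrm{GD}}(\mu)=1$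 if $|\Omega(\mu)|=1$. Put $$\mathrm{min\text{-}gap}_{\mathrm{GD}}(\mu)=\min_{\Lambda\subseteq V,\ \sigma_\Lambda\in\Omega(\mu_\Lambda)}\mathrm{gap}_{\mathrm{GD}}(\mu^{\sigma_\Lambda}),$$ where the Glauber dynamics for $\mu^{\sigma_\Lambda}$, a distribution on $\{-1,+1\}^V$, still picks $v$ uniformly from all of $V$. **Theorem.** Let $\mu$ be a distribution on $\{-1,+1\}^V$ and $\eta>0$. If $\mu$ is completely $\eta$-spectrally independent, then for all $\theta\in(0,1)$, $$\mathrm{gap}_{\mathrm{GD}}(\mu)\ \ge\ \Bigl(\frac{\theta}{2}\Bigr)^{2\eta+7}\cdot\mathrm{min\text{-}gap}_{\mathrm{GD}}\bigl(\mu^{(\theta)}\bigr).$$ -/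

import Mathlib

namespace SpinDistribution

noncomputable section

/-- Configurations in `{-1,+1}^V`; the spin set `{-1,+1}` is `ℤˣ`. -/
abbrev Config (V : Type*) : Type _ := V → ℤˣ

/-- The support `Ω(f)` of a function on a finite set. -/
def supp {α : Type*} [Fintype α] (f : α → ℝ) : Finset α :=
  Finset.univ.filter fun x => f x ≠ 0

/-- Total variation distance of two distributions on a finite set. -/
def tvDist {α : Type*} [Fintype α] (f g : α → ℝ) : ℝ :=
  (1 / 2) * ∑ x, |f x - g x|

section Distributions

variable {V : Type*} [Fintype V] [DecidableEq V]

/-- The marginal `μ_Λ`, a function on `{-1,+1}^Λ`. -/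
def marginal (μ : Config V → ℝ) (Λ : Finset V) (σ : Λ → ℤˣ) : ℝ :=
  ∑ τ : Config V with Λ.restrict τ = σ, μ τ

/-- The conditional distribution `μ^{σ_Λ}` on `{-1,+1}^V`, i.e. `μ` conditioned on the
configuration on `Λ` being `σ`. It is only used for `σ ∈ Ω(μ_Λ)`. -/
def pinned (μ : Config V → ℝ) (Λ : Finset V) (σ : Λ → ℤˣ) : Config V → ℝ :=
  fun τ => if Λ.restrict τ = σ then μ τ / marginal μ Λ σ else 0

/-- The influence of `u` on `v` under `μ`: the maximum over `c, c' ∈ Ω(μ_u)` of the total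
variation distance between the marginals at `v` of `μ` conditioned on `u ← c` and on
`u ← c'`. -/
def influence (μ : Config V → ℝ) (u v : V) : ℝ :=
  ⨆ p : supp (marginal μ {u}) × supp (marginal μ {u}),
    tvDist (marginal (pinned μ {u} p.1) {v}) (marginal (pinned μ {u} p.2) {v})

/-- The (absolute) influence matrix `Ψ_μ^{σ_Λ}`, indexed by `V ∖ Λ`. -/
def influenceMatrix (μ : Config V → ℝ) (Λ : Finset V) (σ : Λ → ℤˣ) :
    Matrix {v : V // v ∉ Λ} {v : V // v ∉ Λ} ℝ :=
  Matrix.of fun u v => if u = v then 0 else influence (pinned μ Λ σ) u v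

/-- `η`-spectral independence: for every feasible pinning, the spectral radius (largest modulus
of a complex eigenvalue) of the influence matrix is at most `η`. -/
def SpectrallyIndependent (μ : Config V → ℝ) (η : ℝ) : Prop :=
  ∀ (Λ : Finset V) (σ : Λ → ℤˣ), σ ∈ supp (marginal μ Λ) →
    spectralRadius ℂ ((influenceMatrix μ Λ σ).map (fun x : ℝ => (x : ℂ))) ≤ ENNReal.ofReal η

/-- The unnormalized weight `μ(σ) ∏_{v : σ_v = +1} φ_v`. -/
def fieldWeight (μ : Config V → ℝ) (φ : V → ℝ) (σ : Config V) : ℝ :=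
  μ σ * ∏ v with σ v = 1, φ v

/-- The magnetized distribution `μ^{(φ)}` with local fields `φ`. -/
def magnetize (μ : Config V → ℝ) (φ : V → ℝ) : Config V → ℝ :=
  fun σ => fieldWeight μ φ σ / ∑ τ, fieldWeight μ φ τ

/-- Complete `η`-spectral independence: `μ^{(φ)}` is `η`-spectrally independent for all
`φ ∈ (0,1]^V`. -/
def CompletelySpectrallyIndependent (μ : Config V → ℝ) (η : ℝ) : Prop :=
  ∀ φ : V → ℝ, (∀ v, φ v ∈ Set.Ioc (0 : ℝ) 1) → SpectrallyIndependent (magnetize μ φ) η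

/-- Transition matrix of the Glauber dynamics on `Ω(μ)`: pick `v ∈ V` uniformly at random, then
resample the spin at `v` from `μ` conditioned on the current configuration on `V ∖ {v}`. -/
def glauber (μ : Config V → ℝ) : Matrix (supp μ) (supp μ) ℝ :=
  Matrix.of fun σ τ =>
    (Fintype.card V : ℝ)⁻¹ *
      ∑ v : V, pinned μ (Finset.univ.erase v) ((Finset.univ.erase v).restrict σ.1) τ.1

end Distributions

/-- The second largest real eigenvalue, counted with algebraic multiplicity, of a square matrix;
it is `0` by convention if there is no second eigenvalue (in particular for a `1 × 1` matrix). -/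
def secondEigenvalue {n : Type*} [Fintype n] [DecidableEq n] (P : Matrix n n ℝ) : ℝ :=
  (P.charpoly.roots.sort (· ≥ ·)).getD 1 0

/-- The spectral gap `1 - λ₂` of the Glauber dynamics for `μ`; it is `1` if `|Ω(μ)| = 1`. -/
def gapGD {V : Type*} [Fintype V] [DecidableEq V] (μ : Config V → ℝ) : ℝ :=
  1 - secondEigenvalue (glauber μ)

/-- The spectral gap up to worst-case pinning: the minimum of the spectral gap of the Glauber
dynamics for `μ^{σ_Λ}` over all `Λ ⊆ V` and `σ_Λ ∈ Ω(μ_Λ)`. -/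
def minGapGD {V : Type*} [Fintype V] [DecidableEq V] (μ : Config V → ℝ) : ℝ :=
  ⨅ p : (Λ : Finset V) × supp (marginal μ Λ), gapGD (pinned μ p.1 p.2.1)

end

end SpinDistribution

/-! The proof interpolates between `μ` and pinnings of `μ^{(θ)}` by the field dynamics. Reveal each
`+1` spin independently with probability `1 - t`. Given the revealed set `R`, the law is `μ^{(t)}`
pinned to `+1` on `R`; with its mass kept this is `plusWeight μ t R`, and `μ = ∑ R, (1 - t) ^ |R| *
plusWeight μ t R` (`sum_pow_mul_plusWeight`).

Let `E(t)` be the expected conditional variance of `f`, so `E(1)` is the variance under `μ`. Its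
derivative is a weighted sum of squared changes of the conditional mean, one for each spin that may
be revealed next. In terms of covariances with spin indicators, spectral independence of `μ^{(t)}`
bounds it: `t E'(t) ≤ (1 + η) E(t)` (`sum_revealTerm_le`). Integrating gives `θ ^ (1 + η) * Var f ≤
E(θ)`.

Each conditional law at time `θ` is a pinning of `μ^{(θ)}`, so its variance times the minimal gap is
at most its Glauber Dirichlet form. The edge weight `ab/(a+b)` is superadditive, so these forms add
up to at most that of `μ` (`sum_dform_le`). The result is a Poincaré inequality for `μ` with the
better constant `θ ^ (1 + η)`. -/

namespace SpinDistribution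

open Matrix

/-! ### Variational characterization of the second eigenvalue of a symmetric matrix. -/

/-- The real spectral theorem in coordinates, with the top two eigenvalues singled out. -/
theorem exists_eigenbasis_secondEigenvalue {n : Type*} [Fintype n] [DecidableEq n]
    {S : Matrix n n ℝ} (hS : S.IsHermitian) (hn : 2 ≤ Fintype.card n) :
    ∃ (u : n → n → ℝ) (e : n → ℝ) (i j : n), i ≠ j ∧ secondEigenvalue S = e j ∧
      (∀ k, k ≠ i → e k ≤ e j) ∧ e j ≤ e i ∧
      (∀ k l, u k ⬝ᵥ u l = if k = l then 1 else 0) ∧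
      (∀ x y, x ⬝ᵥ y = ∑ k, (u k ⬝ᵥ x) * (u k ⬝ᵥ y)) ∧
      ∀ k x, u k ⬝ᵥ (S *ᵥ x) = e k * (u k ⬝ᵥ x) := by
  set E := Fintype.equivOfCardEq (Fintype.card_fin (Fintype.card n)) with hE
  have hinner : ∀ x y : EuclideanSpace ℝ n, inner ℝ x y = x.ofLp ⬝ᵥ y.ofLp := by
    intro x y
    rw [EuclideanSpace.inner_eq_star_dotProduct, dotProduct_comm]
    simp
  have heig : ∀ k, hS.eigenvalues (E k) = hS.eigenvalues₀ k := by
    intro k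
    simp [Matrix.IsHermitian.eigenvalues, hE]
  -- `eigenvalues₀` is the decreasing enumeration, so `i` and `j` are its positions 0 and 1, the
  -- latter matching `getD 1`.
  refine ⟨fun k => hS.eigenvectorBasis k, hS.eigenvalues, E ⟨0, by omega⟩, E ⟨1, by omega⟩,
    ?_, ?_, ?_, ?_, ?_, ?_, ?_⟩
  · simp
  · have h := hS.sort_roots_charpoly_eq_eigenvalues₀
    simp only [RCLike.re_to_real, Multiset.map_id'] at h
    rw [secondEigenvalue, h, heig, List.getD_eq_getElem _ _ (by rw [List.length_ofFn]; omega)]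
    simp
  · intro k hk
    obtain ⟨l, rfl⟩ := E.surjective k
    rw [heig, heig]
    apply hS.eigenvalues₀_antitone
    have : l ≠ ⟨0, by omega⟩ := fun h => hk (by rw [h])
    have : (l : ℕ) ≠ 0 := fun h => this (Fin.ext h)
    rw [Fin.le_def]
    change 1 ≤ (l : ℕ)
    omega
  · rw [heig, heig]
    exact hS.eigenvalues₀_antitone (by rw [Fin.le_def]; exact Nat.zero_le _)
  · intro k l
    rw [← hinner]
    exact orthonormal_iff_ite.mp hS.eigenvectorBasis.orthonormal k l
  · intro x y
    have h := hS.eigenvectorBasis.sum_inner_mul_inner (WithLp.toLp 2 x) (WithLp.toLp 2 y)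
    simp only [hinner] at h
    rw [← h]
    exact Finset.sum_congr rfl fun k _ => by rw [dotProduct_comm x]
  · intro k x
    have hT : Sᵀ = S := by simpa using hS.eq
    rw [dotProduct_mulVec, ← mulVec_transpose, hT, hS.mulVec_eigenvectorBasis, smul_dotProduct,
      smul_eq_mul]

/-- The easy half of the Courant–Fischer principle for the second eigenvalue. -/
theorem secondEigenvalue_le_of_forall_orthogonal {n : Type*} [Fintype n] [DecidableEq n]
    {S : Matrix n n ℝ} (hS : S.IsHermitian) (hn : 2 ≤ Fintype.card n) (s : n → ℝ) (c : ℝ)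
    (h : ∀ x, s ⬝ᵥ x = 0 → x ⬝ᵥ (S *ᵥ x) ≤ c * (x ⬝ᵥ x)) : secondEigenvalue S ≤ c := by
  obtain ⟨u, e, i, j, hij, hsec, -, hle, horth, hpars, hmul⟩ :=
    exists_eigenbasis_secondEigenvalue hS hn
  -- The plane spanned by the top two eigenvectors meets the hyperplane orthogonal to `s`; the
  -- Rayleigh quotient on that plane is at least `e j`.
  obtain ⟨a, b, hab, hs⟩ : ∃ a b : ℝ, 0 < a ^ 2 + b ^ 2 ∧
      a * (s ⬝ᵥ u i) + b * (s ⬝ᵥ u j) = 0 := by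
    by_cases h0 : s ⬝ᵥ u i = 0
    · exact ⟨1, 0, by norm_num, by rw [h0]; ring⟩
    · exact ⟨s ⬝ᵥ u j, -(s ⬝ᵥ u i), by have := sq_pos_of_ne_zero h0; nlinarith [sq_nonneg (s ⬝ᵥ u j)],
        by ring⟩
  have hux : ∀ k, u k ⬝ᵥ (a • u i + b • u j) =
      a * (if k = i then 1 else 0) + b * (if k = j then 1 else 0) := by
    intro k
    simp [dotProduct_add, dotProduct_smul, horth]
  have hsum : ∀ w : n → ℝ, ∑ k, w k *
      (a * (if k = i then 1 else 0) + b * (if k = j then 1 else 0)) ^ 2 =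
      w i * a ^ 2 + w j * b ^ 2 := by
    intro w
    rw [Finset.sum_eq_add_of_mem i j (Finset.mem_univ _) (Finset.mem_univ _) hij]
    · simp [hij, hij.symm]
    · rintro k - ⟨h1, h2⟩
      simp [h1, h2]
  have h1 := h (a • u i + b • u j) (by
    rw [dotProduct_add, dotProduct_smul, dotProduct_smul]; simpa using hs)
  rw [hpars _ (S *ᵥ _), hpars _ (a • u i + b • u j)] at h1
  simp only [hmul, hux] at h1
  have h2 := hsum e
  have h3 := hsum (fun _ => 1)
  simp only [one_mul] at h3
  rw [Finset.sum_congr rfl (fun k _ => show _ = e k *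
      (a * (if k = i then 1 else 0) + b * (if k = j then 1 else 0)) ^ 2 by ring), h2,
    Finset.sum_congr rfl (fun k _ => show _ =
      (a * (if k = i then 1 else 0) + b * (if k = j then 1 else 0)) ^ 2 by ring), h3] at h1
  rw [hsec]
  have h4 : e j * (a ^ 2 + b ^ 2) ≤ c * (a ^ 2 + b ^ 2) := by
    nlinarith [mul_le_mul_of_nonneg_right hle (sq_nonneg a)]
  exact le_of_mul_le_mul_right h4 hab

/-- If `s` is a fixed unit vector of a symmetric contraction `S`, then the Rayleigh quotient on the
orthogonal complement of `s` is at most the second eigenvalue. -/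
theorem rayleigh_le_secondEigenvalue {n : Type*} [Fintype n] [DecidableEq n]
    {S : Matrix n n ℝ} (hS : S.IsHermitian) (hn : 2 ≤ Fintype.card n) (s : n → ℝ)
    (hs : S *ᵥ s = s) (hs1 : s ⬝ᵥ s = 1) (hle1 : ∀ x, x ⬝ᵥ (S *ᵥ x) ≤ x ⬝ᵥ x)
    (x : n → ℝ) (hx : s ⬝ᵥ x = 0) : x ⬝ᵥ (S *ᵥ x) ≤ secondEigenvalue S * (x ⬝ᵥ x) := by
  obtain ⟨u, e, i, j, hij, hsec, hk, hle, horth, hpars, hmul⟩ :=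
    exists_eigenbasis_secondEigenvalue hS hn
  rw [hsec]
  -- If `1 ≤ e j`, contractivity suffices. Otherwise every `e k` with `k ≠ i` is below 1, so the
  -- fixed vector `s` is a multiple of `u i`.
  rcases le_or_gt 1 (e j) with h1 | h1
  · have : 0 ≤ x ⬝ᵥ x := by rw [hpars]; exact Finset.sum_nonneg fun k _ => mul_self_nonneg _
    nlinarith [hle1 x]
  have hz : ∀ k, k ≠ i → u k ⬝ᵥ s = 0 := by
    intro k hki
    have := hmul k s
    rw [hs] at this
    have h2 := hk k hki
    have h3 : (1 - e k) * (u k ⬝ᵥ s) = 0 := by linarith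
    rcases mul_eq_zero.mp h3 with h | h
    · linarith
    · exact h
  have hi : ∀ y, s ⬝ᵥ y = (u i ⬝ᵥ s) * (u i ⬝ᵥ y) := by
    intro y
    rw [hpars, Finset.sum_eq_single i]
    · intro k _ hki
      rw [hz k hki, zero_mul]
    · simp
  have hxi : u i ⬝ᵥ x = 0 := by
    have h2 := hi x
    rw [hx] at h2
    rcases mul_eq_zero.mp h2.symm with h | h
    · have := hi s
      rw [h, hs1] at this
      norm_num at this
    · exact h
  rw [hpars x (S *ᵥ x), hpars x x, Finset.mul_sum]
  apply Finset.sum_le_sum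
  intro k _
  rw [hmul]
  by_cases hki : k = i
  · rw [hki, hxi]; simp
  · nlinarith [mul_le_mul_of_nonneg_right (hk k hki) (mul_self_nonneg (u k ⬝ᵥ x))]

/-! ### Reversible chains: spectral gap and Poincaré inequality. -/

/-- The Dirichlet form `½ ∑ π(i) P(i,j) (f i - f j)²`. -/
noncomputable def chainForm {n : Type*} [Fintype n] (π : n → ℝ) (P : Matrix n n ℝ) (f : n → ℝ) :
    ℝ :=
  (1 / 2) * ∑ i, ∑ j, π i * P i j * (f i - f j) ^ 2

/-- The variance of `f` under the nonnegative weight `w`, multiplied by the total mass of `w`. -/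
noncomputable def wvar {n : Type*} [Fintype n] (w f : n → ℝ) : ℝ :=
  ∑ i, w i * f i ^ 2 - (∑ i, w i * f i) ^ 2 / ∑ i, w i

section Reversible

variable {n : Type*} [Fintype n] {π : n → ℝ} {P : Matrix n n ℝ}

theorem chainForm_eq (hrev : ∀ i j, π i * P i j = π j * P j i) (hrow : ∀ i, ∑ j, P i j = 1)
    (f : n → ℝ) :
    chainForm π P f = ∑ i, π i * f i ^ 2 - ∑ i, ∑ j, π i * P i j * f i * f j := by
  have h1 : ∑ i, ∑ j, π i * P i j * f i ^ 2 = ∑ i, π i * f i ^ 2 := by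
    refine Finset.sum_congr rfl fun i _ => ?_
    rw [← Finset.sum_mul, ← Finset.mul_sum, hrow, mul_one]
  have h2 : ∑ i, ∑ j, π i * P i j * f j ^ 2 = ∑ i, π i * f i ^ 2 := by
    rw [Finset.sum_comm, ← h1]
    exact Finset.sum_congr rfl fun i _ => Finset.sum_congr rfl fun j _ => by rw [hrev j i]
  have h3 : ∑ i, ∑ j, π i * P i j * (f i - f j) ^ 2 =
      ∑ i, ∑ j, π i * P i j * f i ^ 2 + ∑ i, ∑ j, π i * P i j * f j ^ 2
        - 2 * ∑ i, ∑ j, π i * P i j * f i * f j := by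
    simp only [Finset.mul_sum, ← Finset.sum_add_distrib, ← Finset.sum_sub_distrib]
    exact Finset.sum_congr rfl fun i _ => Finset.sum_congr rfl fun j _ => by ring
  rw [chainForm, h3, h1, h2]
  ring

/-- Conjugation by `diag √π` turns reversibility into symmetry and preserves the characteristic
polynomial, hence `secondEigenvalue`. -/
theorem exists_symmetrization [DecidableEq n] (hπ : ∀ i, 0 < π i) (hrev : ∀ i j, π i * P i j = π j * P j i) :
    ∃ S : Matrix n n ℝ, S.IsHermitian ∧ secondEigenvalue P = secondEigenvalue S ∧
      (∀ i j, √(π i) * S i j * √(π j) = π i * P i j) ∧ ∀ i j, S i j = √(π i) * P i j / √(π j) := by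
  have hd : ∀ i, 0 < √(π i) := fun i => Real.sqrt_pos.mpr (hπ i)
  have hdd : ∀ i, √(π i) * √(π i) = π i := fun i => Real.mul_self_sqrt (hπ i).le
  let D : (Matrix n n ℝ)ˣ := ⟨diagonal fun i => √(π i), diagonal fun i => (√(π i))⁻¹, by
    rw [diagonal_mul_diagonal, ← diagonal_one]
    congr 1; ext i; exact mul_inv_cancel₀ (hd i).ne', by
    rw [diagonal_mul_diagonal, ← diagonal_one]
    congr 1; ext i; exact inv_mul_cancel₀ (hd i).ne'⟩
  have hent : ∀ i j, (D.val * P * D⁻¹.val) i j = √(π i) * P i j / √(π j) := by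
    intro i j
    change (diagonal (fun i => √(π i)) * P * diagonal fun i => (√(π i))⁻¹) i j = _
    rw [mul_diagonal, diagonal_mul, div_eq_mul_inv]
  refine ⟨D.val * P * D⁻¹.val, ?_, ?_, ?_, hent⟩
  · ext i j
    rw [conjTranspose_apply, hent, hent, star_trivial]
    have h1 := hd i
    have h2 := hd j
    rw [div_eq_div_iff h1.ne' h2.ne']
    have := hrev i j
    rw [← hdd i, ← hdd j] at this
    linarith
  · rw [secondEigenvalue, secondEigenvalue,
      show (D.val * P * D⁻¹.val).charpoly = P.charpoly by
        rw [coe_units_inv]; exact charpoly_units_conj D P]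
  · intro i j
    rw [hent]
    have h2 := hd j
    field_simp
    rw [Real.sq_sqrt (hπ i).le, mul_comm]

theorem dotProduct_symmetrization {S : Matrix n n ℝ}
    (hS : ∀ i j, √(π i) * S i j * √(π j) = π i * P i j) (f : n → ℝ) :
    (fun i => √(π i) * f i) ⬝ᵥ (S *ᵥ fun i => √(π i) * f i) =
      ∑ i, ∑ j, π i * P i j * f i * f j := by
  simp only [dotProduct, mulVec, Finset.mul_sum]
  exact Finset.sum_congr rfl fun i _ => Finset.sum_congr rfl fun j _ => by rw [← hS]; ring

theorem dotProduct_sqrt_mul (hπ : ∀ i, 0 < π i) (f g : n → ℝ) :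
    (fun i => √(π i) * f i) ⬝ᵥ (fun i => √(π i) * g i) = ∑ i, π i * f i * g i := by
  simp only [dotProduct]
  refine Finset.sum_congr rfl fun i _ => ?_
  linear_combination f i * g i * Real.mul_self_sqrt (hπ i).le

/-- A Poincaré inequality bounds the second eigenvalue of a reversible chain. -/
theorem secondEigenvalue_le_of_poincare [DecidableEq n] (hn : 2 ≤ Fintype.card n) (hπ : ∀ i, 0 < π i)
    (hrev : ∀ i j, π i * P i j = π j * P j i) (hrow : ∀ i, ∑ j, P i j = 1) (c : ℝ)
    (h : ∀ f, c * wvar π f ≤ chainForm π P f) : secondEigenvalue P ≤ 1 - c := by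
  obtain ⟨S, hS, hsec, hSP, -⟩ := exists_symmetrization hπ hrev
  rw [hsec]
  apply secondEigenvalue_le_of_forall_orthogonal hS hn (fun i => √(π i))
  intro x hx
  obtain ⟨f, rfl⟩ : ∃ f : n → ℝ, x = fun i => √(π i) * f i :=
    ⟨fun i => x i / √(π i), funext fun i =>
      (mul_div_cancel₀ _ (Real.sqrt_pos.mpr (hπ i)).ne').symm⟩
  -- Orthogonality to `√π` says that `f` has mean zero, so `wvar` reduces to the second moment.
  have h1 := dotProduct_sqrt_mul hπ (fun _ => 1) f
  simp only [mul_one] at h1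
  rw [hx] at h1
  have h2 := h f
  rw [chainForm_eq hrev hrow, wvar, ← h1] at h2
  rw [dotProduct_symmetrization hSP, dotProduct_sqrt_mul hπ]
  simp only [mul_assoc, ← pow_two, ne_eq, OfNat.ofNat_ne_zero, not_false_eq_true, zero_pow,
    zero_div, sub_zero] at h2 ⊢
  linarith

/-- A reversible chain satisfies the Poincaré inequality with its spectral gap. -/
theorem poincare_secondEigenvalue [DecidableEq n] (hn : 2 ≤ Fintype.card n) (hπ : ∀ i, 0 < π i)
    (hπ1 : ∑ i, π i = 1) (hP : ∀ i j, 0 ≤ P i j)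
    (hrev : ∀ i j, π i * P i j = π j * P j i) (hrow : ∀ i, ∑ j, P i j = 1) (f : n → ℝ) :
    (1 - secondEigenvalue P) * wvar π f ≤ chainForm π P f := by
  obtain ⟨S, hS, hsec, hSP, hent⟩ := exists_symmetrization hπ hrev
  have hd : ∀ i, 0 < √(π i) := fun i => Real.sqrt_pos.mpr (hπ i)
  have hnn : ∀ f, 0 ≤ chainForm π P f := fun f => by
    refine mul_nonneg (by norm_num) (Finset.sum_nonneg fun i _ => Finset.sum_nonneg fun j _ => ?_)
    exact mul_nonneg (mul_nonneg (hπ i).le (hP i j)) (sq_nonneg _)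
  have hss : ((fun i => √(π i)) ⬝ᵥ fun i => √(π i)) = 1 := by
    have := dotProduct_sqrt_mul hπ (fun _ => 1) (fun _ => 1)
    simpa [hπ1] using this
  have hfix : (S *ᵥ fun i => √(π i)) = fun i => √(π i) := by
    ext i
    simp only [mulVec, dotProduct]
    rw [Finset.sum_congr rfl fun j _ => show S i j * √(π j) = √(π i) * P i j by
      rw [hent, div_mul_cancel₀ _ (hd j).ne'], ← Finset.mul_sum, hrow, mul_one]
  have hcontr : ∀ x, x ⬝ᵥ (S *ᵥ x) ≤ x ⬝ᵥ x := by
    intro x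
    obtain ⟨f, rfl⟩ : ∃ f : n → ℝ, x = fun i => √(π i) * f i :=
      ⟨fun i => x i / √(π i), funext fun i => (mul_div_cancel₀ _ (hd i).ne').symm⟩
    have h2 := hnn f
    rw [chainForm_eq hrev hrow] at h2
    rw [dotProduct_symmetrization hSP, dotProduct_sqrt_mul hπ]
    simp only [mul_assoc, ← pow_two] at h2 ⊢
    linarith
  set m := ∑ i, π i * f i with hm
  have h0 : ∑ i, π i * (f i - m) = 0 := by
    simp only [mul_sub, Finset.sum_sub_distrib, ← Finset.sum_mul, hπ1, ← hm]
    ring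
  have hsq : ∑ i, π i * (f i - m) ^ 2 = wvar π f := by
    have : ∀ i, π i * (f i - m) ^ 2 = π i * f i ^ 2 - 2 * m * (π i * f i) + m ^ 2 * π i :=
      fun i => by ring
    simp only [this, Finset.sum_add_distrib, Finset.sum_sub_distrib, ← Finset.mul_sum, hπ1, ← hm,
      wvar]
    ring
  have h1 := dotProduct_sqrt_mul hπ (fun _ => 1) (fun i => f i - m)
  simp only [mul_one] at h1
  have h2 := rayleigh_le_secondEigenvalue hS hn _ hfix hss hcontr
    (fun i => √(π i) * (f i - m)) (by rw [h1, h0])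
  have h3 : chainForm π P f = chainForm π P fun i => f i - m := by
    simp [chainForm]
  rw [dotProduct_symmetrization hSP, dotProduct_sqrt_mul hπ] at h2
  rw [h3, chainForm_eq hrev hrow, hsec, ← hsq]
  simp only [mul_assoc, ← pow_two] at h2 ⊢
  linarith

end Reversible

theorem secondEigenvalue_eq_zero_of_card_le_one {n : Type*} [Fintype n] [DecidableEq n]
    (P : Matrix n n ℝ) (hn : Fintype.card n ≤ 1) : secondEigenvalue P = 0 := by
  rw [secondEigenvalue, List.getD_eq_default]
  rw [Multiset.length_sort]
  refine (Polynomial.card_roots' _).trans ?_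
  rwa [charpoly_natDegree_eq_dim]

end SpinDistribution

namespace SpinDistribution

open Matrix

/-! ### Variance under unnormalized weights, and the Dirichlet form of Glauber dynamics. -/

section WeightedVariance

variable {n : Type*} [Fintype n]

theorem wvar_smul (c : ℝ) (w f : n → ℝ) : wvar (fun i => c * w i) f = c * wvar w f := by
  simp only [wvar, mul_assoc, ← Finset.mul_sum]
  rcases eq_or_ne c 0 with rfl | hc
  · simp
  · rw [mul_pow, mul_sub, sq c, mul_assoc, mul_div_mul_left _ _ hc]
    ring

theorem wvar_nonneg {w : n → ℝ} (hw : ∀ i, 0 ≤ w i) (f : n → ℝ) : 0 ≤ wvar w f := by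
  rcases (Finset.sum_nonneg fun i (_ : i ∈ Finset.univ) => hw i).eq_or_lt' with h | h
  · rw [wvar, h, div_zero, sub_zero]
    exact Finset.sum_nonneg fun i _ => mul_nonneg (hw i) (sq_nonneg _)
  · rw [wvar, sub_nonneg, div_le_iff₀ h]
    refine Finset.sum_sq_le_sum_mul_sum_of_sq_le_mul Finset.univ
      (fun i _ => mul_nonneg (hw i) (sq_nonneg (f i))) (fun i _ => hw i)
      fun i _ => le_of_eq (by ring)

theorem wvar_of_subsingleton [Subsingleton n] (w f : n → ℝ) : wvar w f = 0 := by
  rcases isEmpty_or_nonempty n with h | ⟨⟨i⟩⟩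
  · simp [wvar]
  · have : Unique n := ⟨⟨i⟩, fun _ => Subsingleton.elim _ _⟩
    simp only [wvar, Finset.univ_unique, Finset.sum_singleton]
    rcases eq_or_ne (w default) 0 with h | h
    · simp [h]
    · field_simp
      ring

end WeightedVariance

variable {V : Type*} [DecidableEq V]

/-- The configuration `σ` with the spin at `v` reversed. -/
def flip (v : V) (σ : Config V) : Config V := Function.update σ v (-σ v)

theorem flip_ne (v : V) (σ : Config V) : flip v σ ≠ σ := by
  intro h
  have := congrFun h v
  rw [flip, Function.update_self] at this
  rcases Int.units_eq_one_or (σ v) with h | h <;> rw [h] at this <;> exact absurd this (by decide)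

variable [Fintype V]

theorem restrict_erase_eq_iff (v : V) (σ τ : Config V) :
    (Finset.univ.erase v).restrict τ = (Finset.univ.erase v).restrict σ ↔
      τ = σ ∨ τ = flip v σ := by
  have hiff : (Finset.univ.erase v).restrict τ = (Finset.univ.erase v).restrict σ ↔
      ∀ u, u ≠ v → τ u = σ u := by
    rw [funext_iff]
    exact ⟨fun h u hu => h ⟨u, by simp [hu]⟩, fun h u => h u.1 (Finset.ne_of_mem_erase u.2)⟩
  rw [hiff]
  constructor
  · intro h
    rcases eq_or_ne (τ v) (σ v) with hv | hv
    · left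
      ext1 u
      by_cases hu : u = v
      · rw [hu, hv]
      · exact h u hu
    · right
      ext1 u
      by_cases hu : u = v
      · rw [hu, flip, Function.update_self]
        exact Int.units_ne_iff_eq_neg.mp hv
      · rw [flip, Function.update_of_ne hu, h u hu]
  · rintro (rfl | rfl) u hu
    · rfl
    · rw [flip, Function.update_of_ne hu]

theorem sum_ite_restrict_erase (v : V) (σ : Config V) (F : Config V → ℝ) :
    (∑ τ, if (Finset.univ.erase v).restrict τ = (Finset.univ.erase v).restrict σ then F τ else 0) =
      F σ + F (flip v σ) := by
  simp only [restrict_erase_eq_iff]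
  rw [← Finset.sum_filter]
  rw [show (Finset.univ.filter fun τ => τ = σ ∨ τ = flip v σ) = {σ, flip v σ} by ext; simp]
  exact Finset.sum_pair (flip_ne v σ).symm

theorem marginal_erase (μ : Config V → ℝ) (v : V) (σ : Config V) :
    marginal μ (Finset.univ.erase v) ((Finset.univ.erase v).restrict σ) = μ σ + μ (flip v σ) := by
  rw [marginal, Finset.sum_filter, sum_ite_restrict_erase]

theorem sum_pinned_erase_mul (μ : Config V → ℝ) (v : V) (σ : Config V) (F : Config V → ℝ) :
    ∑ τ, pinned μ (Finset.univ.erase v) ((Finset.univ.erase v).restrict σ) τ * F τ =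
      (μ σ * F σ + μ (flip v σ) * F (flip v σ)) / (μ σ + μ (flip v σ)) := by
  simp only [pinned, marginal_erase, ite_mul, zero_mul]
  rw [sum_ite_restrict_erase]
  ring

/-- The Dirichlet form of the Glauber dynamics of a nonnegative weight. -/
noncomputable def dform (a f : Config V → ℝ) : ℝ :=
  (1 / 2) * ((Fintype.card V : ℝ)⁻¹ * ∑ v : V, ∑ σ : Config V,
    a σ * a (flip v σ) / (a σ + a (flip v σ)) * (f σ - f (flip v σ)) ^ 2)

theorem dform_smul (c : ℝ) (a f : Config V → ℝ) : dform (fun σ => c * a σ) f = c * dform a f := by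
  rcases eq_or_ne c 0 with rfl | hc
  · simp [dform]
  · have : ∀ v σ, c * a σ * (c * a (flip v σ)) / (c * a σ + c * a (flip v σ)) =
        c * (a σ * a (flip v σ) / (a σ + a (flip v σ))) := by
      intro v σ
      rw [← mul_add, mul_assoc, mul_div_mul_left _ _ hc]
      ring
    simp only [dform, this]
    simp only [mul_assoc c, ← Finset.mul_sum]
    ring

theorem dform_nonneg {a : Config V → ℝ} (ha : ∀ σ, 0 ≤ a σ) (f : Config V → ℝ) :
    0 ≤ dform a f := by
  refine mul_nonneg (by norm_num) (mul_nonneg (by positivity)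
    (Finset.sum_nonneg fun v _ => Finset.sum_nonneg fun σ _ => mul_nonneg ?_ (sq_nonneg _)))
  exact div_nonneg (mul_nonneg (ha _) (ha _)) (add_nonneg (ha _) (ha _))

/-- `ab/(a+b)` is the minimum over `t` of `t²a + (1-t)²b`, an infimum of linear functions of `(a,
b)`, hence superadditive. The `t` used is the minimizer `B/(A+B)` for the sums. -/
theorem sum_parallel_le {ι : Type*} (s : Finset ι) (a b : ι → ℝ) (ha : ∀ i, 0 ≤ a i)
    (hb : ∀ i, 0 ≤ b i) :
    ∑ i ∈ s, a i * b i / (a i + b i) ≤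
      (∑ i ∈ s, a i) * (∑ i ∈ s, b i) / (∑ i ∈ s, a i + ∑ i ∈ s, b i) := by
  have hA : 0 ≤ ∑ i ∈ s, a i := Finset.sum_nonneg fun i _ => ha i
  have hB : 0 ≤ ∑ i ∈ s, b i := Finset.sum_nonneg fun i _ => hb i
  set A := ∑ i ∈ s, a i with hAd
  set B := ∑ i ∈ s, b i with hBd
  have key : ∀ i t, a i * b i / (a i + b i) ≤ t ^ 2 * a i + (1 - t) ^ 2 * b i := by
    intro i t
    rcases (add_nonneg (ha i) (hb i)).eq_or_lt' with h | h
    · rw [h, div_zero]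
      have := ha i
      have := hb i
      positivity
    · rw [div_le_iff₀ h]
      nlinarith [sq_nonneg (t * a i - (1 - t) * b i)]
  calc ∑ i ∈ s, a i * b i / (a i + b i)
      ≤ ∑ i ∈ s, ((B / (A + B)) ^ 2 * a i + (1 - B / (A + B)) ^ 2 * b i) :=
        Finset.sum_le_sum fun i _ => key i _
    _ = (B / (A + B)) ^ 2 * A + (1 - B / (A + B)) ^ 2 * B := by
        rw [Finset.sum_add_distrib, ← Finset.mul_sum, ← Finset.mul_sum]
    _ ≤ A * B / (A + B) := by
        rcases (add_nonneg hA hB).eq_or_lt' with h | h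
        · have h1 : A = 0 := by linarith
          have h2 : B = 0 := by linarith
          rw [h1, h2]
          simp
        · apply le_of_eq
          field_simp
          ring

/-- The Dirichlet form is superadditive in the weight. -/
theorem sum_dform_le {ι : Type*} (s : Finset ι) (a : ι → Config V → ℝ) (ha : ∀ i σ, 0 ≤ a i σ)
    (f : Config V → ℝ) : ∑ i ∈ s, dform (a i) f ≤ dform (fun σ => ∑ i ∈ s, a i σ) f := by
  simp only [dform, ← Finset.mul_sum]
  refine mul_le_mul_of_nonneg_left (mul_le_mul_of_nonneg_left ?_ (by positivity)) (by norm_num)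
  rw [Finset.sum_comm]
  refine Finset.sum_le_sum fun v _ => ?_
  rw [Finset.sum_comm]
  refine Finset.sum_le_sum fun σ _ => ?_
  rw [← Finset.sum_mul]
  exact mul_le_mul_of_nonneg_right
    (sum_parallel_le s _ _ (fun i => ha i σ) fun i => ha i _) (sq_nonneg _)

/-- Lets sums over the state space `supp μ` run over all configurations, so that different weights
can be compared. -/
theorem sum_supp {α : Type*} [Fintype α] (μ F : α → ℝ) (h : ∀ x, μ x = 0 → F x = 0) :
    ∑ x : supp μ, F x = ∑ x, F x := by
  rw [Finset.sum_coe_sort (supp μ) F, supp, Finset.sum_filter_of_ne]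
  intro x _ hx hμ
  exact hx (h x hμ)

/-! ### The Glauber gap as the best Poincaré constant, and its minimum over pinnings. -/

section Gap

variable {μ : Config V → ℝ}

theorem supp_pos (h0 : ∀ σ, 0 ≤ μ σ) (σ : supp μ) : 0 < μ σ := by
  have := σ.2
  simp only [supp, Finset.mem_filter] at this
  exact lt_of_le_of_ne (h0 _) (Ne.symm this.2)

theorem pinned_erase_zero {v : V} (σ : Config V) {τ : Config V} (h : μ τ = 0) :
    pinned μ (Finset.univ.erase v) ((Finset.univ.erase v).restrict σ) τ = 0 := by
  simp [pinned, h]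

theorem wvar_supp (f : Config V → ℝ) : wvar (fun σ : supp μ => μ σ) (fun σ => f σ) = wvar μ f := by
  simp only [wvar]
  rw [sum_supp μ (fun σ => μ σ * f σ ^ 2) fun x hx => by simp [hx],
    sum_supp μ (fun σ => μ σ * f σ) fun x hx => by simp [hx], sum_supp μ μ fun x hx => hx]

theorem chainForm_glauber (f : Config V → ℝ) :
    chainForm (fun σ : supp μ => μ σ) (glauber μ) (fun σ => f σ) = dform μ f := by
  simp only [chainForm, glauber, of_apply, dform]
  congr 1
  have h1 : ∀ σ : Config V, ∑ τ : supp μ, μ σ * ((Fintype.card V : ℝ)⁻¹ *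
      ∑ v : V, pinned μ (Finset.univ.erase v) ((Finset.univ.erase v).restrict σ) τ.1) *
        (f σ - f τ) ^ 2 = (Fintype.card V : ℝ)⁻¹ * ∑ v : V,
          μ σ * μ (flip v σ) / (μ σ + μ (flip v σ)) * (f σ - f (flip v σ)) ^ 2 := by
    intro σ
    rw [sum_supp μ (fun τ => μ σ * ((Fintype.card V : ℝ)⁻¹ *
      ∑ v : V, pinned μ (Finset.univ.erase v) ((Finset.univ.erase v).restrict σ) τ) *
        (f σ - f τ) ^ 2)]
    · calc _ = ∑ τ, ∑ v, (Fintype.card V : ℝ)⁻¹ * (μ σ *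
            (pinned μ (Finset.univ.erase v) ((Finset.univ.erase v).restrict σ) τ *
              (f σ - f τ) ^ 2)) := by
            refine Finset.sum_congr rfl fun τ _ => ?_
            rw [← Finset.mul_sum, ← Finset.mul_sum, ← Finset.sum_mul]
            ring
        _ = _ := by
            rw [Finset.sum_comm, Finset.mul_sum]
            refine Finset.sum_congr rfl fun v _ => ?_
            rw [← Finset.mul_sum, ← Finset.mul_sum,
              sum_pinned_erase_mul μ v σ fun τ => (f σ - f τ) ^ 2]
            ring
    · intro τ hτ
      simp [pinned_erase_zero σ hτ]
  simp only [h1]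
  rw [sum_supp μ (fun σ => (Fintype.card V : ℝ)⁻¹ * ∑ v : V,
          μ σ * μ (flip v σ) / (μ σ + μ (flip v σ)) * (f σ - f (flip v σ)) ^ 2)
    fun x hx => by simp [hx], ← Finset.mul_sum, Finset.sum_comm]

theorem glauber_nonneg (h0 : ∀ σ, 0 ≤ μ σ) (σ τ : supp μ) : 0 ≤ glauber μ σ τ := by
  refine mul_nonneg (by positivity) (Finset.sum_nonneg fun v _ => ?_)
  rw [pinned]
  split_ifs
  · exact div_nonneg (h0 _) (Finset.sum_nonneg fun _ _ => h0 _)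
  · exact le_rfl

theorem glauber_reversible (σ τ : supp μ) : μ σ * glauber μ σ τ = μ τ * glauber μ τ σ := by
  simp only [glauber, of_apply, Finset.mul_sum]
  refine Finset.sum_congr rfl fun v _ => ?_
  simp only [pinned]
  by_cases h : (Finset.univ.erase v).restrict τ.1 = (Finset.univ.erase v).restrict σ.1
  · rw [if_pos h, if_pos h.symm, h]
    ring
  · rw [if_neg h, if_neg (Ne.symm h)]
    ring

/-- For empty `V` the factor `(card V)⁻¹` is `0` and the rows would sum to zero. -/
theorem sum_glauber [Nonempty V] (h0 : ∀ σ, 0 ≤ μ σ) (σ : supp μ) : ∑ τ, glauber μ σ τ = 1 := by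
  simp only [glauber, of_apply]
  rw [← Finset.mul_sum, Finset.sum_comm]
  have : ∀ v : V, ∑ τ : supp μ,
      pinned μ (Finset.univ.erase v) ((Finset.univ.erase v).restrict σ.1) τ.1 = 1 := by
    intro v
    rw [sum_supp μ (fun τ => pinned μ (Finset.univ.erase v) ((Finset.univ.erase v).restrict σ.1) τ)
      fun τ hτ => pinned_erase_zero _ hτ]
    have := sum_pinned_erase_mul μ v σ fun _ => 1
    simp only [mul_one] at this
    rw [this, div_self]
    exact (add_pos_of_pos_of_nonneg (supp_pos h0 σ) (h0 _)).ne'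
  rw [Finset.sum_congr rfl fun v _ => this v]
  simp

theorem nonempty_of_two_le_card_supp (h : 2 ≤ Fintype.card (supp μ)) : Nonempty V := by
  by_contra hV
  rw [not_nonempty_iff] at hV
  have : Fintype.card (supp μ) ≤ 1 := Fintype.card_le_one_iff_subsingleton.mpr inferInstance
  omega

theorem gapGD_eq_one (h : Fintype.card (supp μ) ≤ 1) : gapGD μ = 1 := by
  rw [gapGD, secondEigenvalue_eq_zero_of_card_le_one _ h, sub_zero]

/-- The Poincaré inequality for the Glauber dynamics. -/
theorem gapGD_mul_wvar_le (hμ : μ ∈ stdSimplex ℝ (Config V)) (f : Config V → ℝ) :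
    gapGD μ * wvar μ f ≤ dform μ f := by
  rcases lt_or_ge (Fintype.card (supp μ)) 2 with h | h
  · have : Subsingleton (supp μ) := Fintype.card_le_one_iff_subsingleton.mp (by omega)
    rw [← wvar_supp, wvar_of_subsingleton, mul_zero]
    exact dform_nonneg hμ.1 f
  · have := nonempty_of_two_le_card_supp h
    rw [← wvar_supp, ← chainForm_glauber]
    exact poincare_secondEigenvalue h (supp_pos hμ.1)
      ((sum_supp μ μ fun _ hx => hx).trans hμ.2) (glauber_nonneg hμ.1) glauber_reversible
      (sum_glauber hμ.1) _

/-- On a one-point support the Poincaré inequality carries no information; there the gap is 1 by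
convention, whence `c ≤ 1`. -/
theorem le_gapGD_of_poincare (hμ : μ ∈ stdSimplex ℝ (Config V)) {c : ℝ} (hc : c ≤ 1)
    (h : ∀ f, c * wvar μ f ≤ dform μ f) : c ≤ gapGD μ := by
  rcases lt_or_ge (Fintype.card (supp μ)) 2 with hn | hn
  · rwa [gapGD_eq_one (by omega)]
  · have := nonempty_of_two_le_card_supp hn
    have := secondEigenvalue_le_of_poincare (P := glauber μ) hn (supp_pos hμ.1) glauber_reversible
      (sum_glauber hμ.1) c fun g => by
        obtain ⟨f, rfl⟩ : ∃ f : Config V → ℝ, g = fun σ : supp μ => f σ :=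
          ⟨fun σ => if hσ : σ ∈ supp μ then g ⟨σ, hσ⟩ else 0, by ext σ; simp⟩
        rw [wvar_supp, chainForm_glauber]
        exact h f
    rw [gapGD]
    linarith

theorem gapGD_nonneg (hμ : μ ∈ stdSimplex ℝ (Config V)) : 0 ≤ gapGD μ :=
  le_gapGD_of_poincare hμ zero_le_one fun f => by
    rw [zero_mul]
    exact dform_nonneg hμ.1 f

theorem pinned_mem_stdSimplex (h0 : ∀ σ, 0 ≤ μ σ) {Λ : Finset V} {σ : Λ → ℤˣ}
    (hσ : σ ∈ supp (marginal μ Λ)) : pinned μ Λ σ ∈ stdSimplex ℝ (Config V) := by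
  simp only [supp, Finset.mem_filter, Finset.mem_univ, true_and] at hσ
  constructor
  · intro τ
    rw [pinned]
    split_ifs
    · exact div_nonneg (h0 _) (Finset.sum_nonneg fun _ _ => h0 _)
    · exact le_rfl
  · simp only [pinned]
    rw [← Finset.sum_filter, ← Finset.sum_div]
    exact div_self hσ

theorem minGapGD_le (μ : Config V → ℝ) {Λ : Finset V} {σ : Λ → ℤˣ}
    (hσ : σ ∈ supp (marginal μ Λ)) : minGapGD μ ≤ gapGD (pinned μ Λ σ) :=
  ciInf_le (f := fun p : (Λ : Finset V) × supp (marginal μ Λ) => gapGD (pinned μ p.1 p.2.1))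
    (Set.finite_range _).bddBelow ⟨Λ, σ, hσ⟩

theorem minGapGD_nonneg (h0 : ∀ σ, 0 ≤ μ σ) : 0 ≤ minGapGD μ :=
  Real.iInf_nonneg fun p => gapGD_nonneg (pinned_mem_stdSimplex h0 p.2.2)

/-- Pinning every vertex to a configuration of positive mass leaves a point mass, whose gap is 1. -/
theorem minGapGD_le_one (hμ : μ ∈ stdSimplex ℝ (Config V)) : minGapGD μ ≤ 1 := by
  obtain ⟨τ, hτ⟩ : ∃ τ, μ τ ≠ 0 := by
    by_contra! h
    have := hμ.2
    simp [h] at this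
  have hiff : ∀ ρ : Config V, (Finset.univ : Finset V).restrict ρ =
      (Finset.univ : Finset V).restrict τ ↔ ρ = τ := fun ρ =>
    ⟨fun h => funext fun u => congrFun h ⟨u, Finset.mem_univ u⟩, fun h => by rw [h]⟩
  have hm : marginal μ Finset.univ ((Finset.univ : Finset V).restrict τ) = μ τ := by
    simp only [marginal, hiff, Finset.filter_eq']
    simp
  have hmem : (Finset.univ : Finset V).restrict τ ∈ supp (marginal μ Finset.univ) := by
    simpa [supp, hm] using hτ
  refine (minGapGD_le μ hmem).trans (gapGD_eq_one ?_).le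
  rw [Fintype.card_le_one_iff]
  have : ∀ ρ : supp (pinned μ Finset.univ ((Finset.univ : Finset V).restrict τ)), ρ.1 = τ := by
    intro ρ
    have h := ρ.2
    simp only [supp, Finset.mem_filter, pinned, hiff] at h
    by_contra hne
    exact h.2 (if_neg hne)
  exact fun a b => Subtype.ext ((this a).trans (this b).symm)

end Gap

end SpinDistribution

namespace SpinDistribution

open Matrix

/-! ### Spectral radius of a nonnegative matrix and domination of quadratic forms. -/

section Perron

variable {ι : Type*} [Fintype ι] [DecidableEq ι]

/-- Collatz–Wielandt bound: a nonnegative subinvariant vector bounds the spectral radius of a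
nonnegative matrix from below. -/
theorem le_of_smul_le_mulVec {N : Matrix ι ι ℝ} (hN : ∀ i j, 0 ≤ N i j) {η : ℝ} (hη : 0 ≤ η)
    (hρ : spectralRadius ℂ (N.map fun x : ℝ => (x : ℂ)) ≤ ENNReal.ofReal η) {y : ι → ℝ}
    (hy : ∀ i, 0 ≤ y i) (hy0 : y ≠ 0) {r : ℝ} (hr : 0 ≤ r)
    (h : ∀ i, r * y i ≤ (N *ᵥ y) i) : r ≤ η := by
  have hpow : ∀ k i, r ^ k * y i ≤ ((N ^ k) *ᵥ y) i := by
    intro k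
    induction k with
    | zero => simp
    | succ k ih =>
      intro i
      rw [pow_succ', pow_succ', ← mulVec_mulVec]
      calc r * r ^ k * y i = r ^ k * (r * y i) := by ring
        _ ≤ r ^ k * (N *ᵥ y) i := mul_le_mul_of_nonneg_left (h i) (pow_nonneg hr k)
        _ = ∑ j, N i j * (r ^ k * y j) := by
          rw [mulVec, dotProduct, Finset.mul_sum]
          exact Finset.sum_congr rfl fun j _ => by ring
        _ ≤ _ := Finset.sum_le_sum fun j _ => mul_le_mul_of_nonneg_left (ih j) (hN i j)
  obtain ⟨i0, hi0⟩ : ∃ i, y i ≠ 0 := by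
    by_contra! hc
    exact hy0 (funext hc)
  -- At a maximal coordinate of `y`, the iterated inequality gives `r ^ k ≤ ‖M ^ k‖` in the `ℓ^∞`
  -- operator norm; Gelfand's formula then concludes.
  obtain ⟨i, -, hi⟩ := Finset.exists_max_image Finset.univ y ⟨i0, Finset.mem_univ _⟩
  have hipos : 0 < y i := lt_of_lt_of_le (lt_of_le_of_ne (hy _) hi0.symm) (hi i0 (Finset.mem_univ _))
  let _ : NormedRing (Matrix ι ι ℂ) := Matrix.linftyOpNormedRing
  let _ : NormedAlgebra ℂ (Matrix ι ι ℂ) := Matrix.linftyOpNormedAlgebra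
  have : CompleteSpace (Matrix ι ι ℂ) := FiniteDimensional.complete ℂ _
  set M : Matrix ι ι ℂ := N.map fun x : ℝ => (x : ℂ) with hM
  have hMk : ∀ k, M ^ k = (N ^ k).map fun x : ℝ => (x : ℂ) := fun k =>
    (map_pow (Complex.ofRealHom.mapMatrix) N k).symm
  have hnorm : ∀ k, r ^ k ≤ ‖M ^ k‖ := by
    intro k
    have hyn : ‖fun j => (y j : ℂ)‖ ≤ y i := by
      rw [pi_norm_le_iff_of_nonneg hipos.le]
      intro j
      rw [Complex.norm_real, Real.norm_of_nonneg (hy j)]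
      exact hi j (Finset.mem_univ _)
    have h1 : ((M ^ k) *ᵥ fun j => (y j : ℂ)) i = (((N ^ k) *ᵥ y) i : ℝ) := by
      rw [hMk]
      simp [mulVec, dotProduct]
    have h2 : r ^ k * y i ≤ ‖M ^ k‖ * y i := by
      calc r ^ k * y i ≤ ((N ^ k) *ᵥ y) i := hpow k i
        _ ≤ ‖((M ^ k) *ᵥ fun j => (y j : ℂ)) i‖ := by
          rw [h1, Complex.norm_real]
          exact le_abs_self _
        _ ≤ ‖(M ^ k) *ᵥ fun j => (y j : ℂ)‖ := norm_le_pi_norm _ i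
        _ ≤ ‖M ^ k‖ * ‖fun j => (y j : ℂ)‖ := linfty_opNorm_mulVec _ _
        _ ≤ _ := mul_le_mul_of_nonneg_left hyn (norm_nonneg _)
    exact le_of_mul_le_mul_right h2 hipos
  have hlim := spectrum.pow_nnnorm_pow_one_div_tendsto_nhds_spectralRadius M
  have hle : ENNReal.ofReal r ≤ spectralRadius ℂ M := by
    refine ge_of_tendsto hlim ?_
    filter_upwards [Filter.eventually_ge_atTop 1] with k hk
    have hk0 : (k : ℝ) ≠ 0 := by positivity
    calc ENNReal.ofReal r = ((ENNReal.ofReal r) ^ (k : ℝ)) ^ (1 / k : ℝ) := by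
          rw [← ENNReal.rpow_mul, mul_one_div_cancel hk0, ENNReal.rpow_one]
      _ ≤ _ := by
          refine ENNReal.rpow_le_rpow ?_ (by positivity)
          rw [ENNReal.rpow_natCast, ← ENNReal.ofReal_pow hr,
            ← ENNReal.ofReal_coe_nnreal]
          exact ENNReal.ofReal_le_ofReal (hnorm k)
  exact (ENNReal.ofReal_le_ofReal_iff hη).mp (hle.trans hρ)

/-- If a symmetric matrix `C` is dominated by `diag p * (N + 1)` then its normalization by
`p ^ (-1/2)` on both sides is at most `1 + ρ(N)`. -/
theorem quadratic_le_of_dominated {N C : Matrix ι ι ℝ} (hN : ∀ i j, 0 ≤ N i j) {η : ℝ}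
    (hη : 0 ≤ η) (hρ : spectralRadius ℂ (N.map fun x : ℝ => (x : ℂ)) ≤ ENNReal.ofReal η)
    {p : ι → ℝ} (hp : ∀ i, 0 ≤ p i) (hC : ∀ i j, C i j = C j i)
    (hdom : ∀ i j, |C i j| ≤ p i * (N + 1) i j) (x : ι → ℝ) :
    ∑ i, ∑ j, C i j / (√(p i) * √(p j)) * x i * x j ≤ (1 + η) * ∑ i, x i ^ 2 := by
  set W : Matrix ι ι ℝ := Matrix.of fun i j => C i j / (√(p i) * √(p j)) with hW
  set B : Matrix ι ι ℝ := (1 + η) • (1 : Matrix ι ι ℝ) - W with hBdef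
  have hB : B.IsHermitian := by
    ext i j
    simp only [hBdef, hW, conjTranspose_apply, star_trivial, Matrix.sub_apply, Matrix.smul_apply,
      one_apply, of_apply, hC i j, mul_comm (√(p i)), eq_comm (a := i)]
  have hpsd : B.PosSemidef := by
    rw [hB.posSemidef_iff_eigenvalues_nonneg]
    intro k
    change 0 ≤ hB.eigenvalues k
    -- A negative eigenvalue of `B` is an eigenvalue `l > 1 + η` of `W`. Entrywise `|W|` is at most
    -- `diag √p * (N + 1) * diag (1/√p)`, so `|z| / √p` is subinvariant for `N` with factor `l - 1 >
    -- η`.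
    by_contra! hneg
    set z : ι → ℝ := ⇑(hB.eigenvectorBasis k) with hz
    have hz0 : z ≠ 0 := by
      intro h0
      have h1 : hB.eigenvectorBasis k = 0 := by
        ext i
        exact congrFun h0 i
      exact hB.eigenvectorBasis.orthonormal.ne_zero k h1
    set l := 1 + η - hB.eigenvalues k with hl
    have heig : W *ᵥ z = l • z := by
      have h1 := hB.mulVec_eigenvectorBasis k
      have h2 : B *ᵥ z = (1 + η) • z - W *ᵥ z := by
        rw [hBdef, sub_mulVec, smul_mulVec, one_mulVec]
      rw [hl, sub_smul, ← h1, h2]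
      abel
    have hlpos : 1 + η < l := by linarith
    have hW0 : ∀ i j, p i = 0 → W i j = 0 := by
      intro i j hi
      simp [hW, hi]
    -- Where `p i = 0`, division by zero makes row `i` of `W` vanish, and `l ≠ 0` kills `z i`.
    have hzero : ∀ i, p i = 0 → z i = 0 := by
      intro i hi
      have h1 := congrFun heig i
      simp only [mulVec, dotProduct, Pi.smul_apply, smul_eq_mul] at h1
      rw [Finset.sum_eq_zero fun j _ => by rw [hW0 i j hi, zero_mul]] at h1
      rcases mul_eq_zero.mp h1.symm with h | h
      · linarith
      · exact h
    have hfin : l - 1 ≤ η := by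
      refine le_of_smul_le_mulVec hN hη hρ (y := fun i => |z i| / √(p i))
        (fun i => by positivity) ?_ (by linarith) ?_
      · intro h0
        apply hz0
        ext i
        by_cases hi : p i = 0
        · exact hzero i hi
        · have h1 := congrFun h0 i
          have : √(p i) ≠ 0 := Real.sqrt_ne_zero'.mpr (lt_of_le_of_ne (hp i) (Ne.symm hi))
          simpa [this] using h1
      · intro i
        by_cases hi : p i = 0
        · simp only [hi, Real.sqrt_zero, div_zero, mul_zero]
          exact Finset.sum_nonneg fun j _ => mul_nonneg (hN _ _) (by positivity)
        have hpi : 0 < p i := lt_of_le_of_ne (hp i) (Ne.symm hi)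
        have hsi : 0 < √(p i) := Real.sqrt_pos.mpr hpi
        have h1 := congrFun heig i
        simp only [mulVec, dotProduct, Pi.smul_apply, smul_eq_mul] at h1
        have h2 : l * |z i| ≤ ∑ j, √(p i) * ((N + 1) i j * (|z j| / √(p j))) := by
          calc l * |z i| = |l * z i| := by rw [abs_mul, abs_of_pos (by linarith : 0 < l)]
            _ = |∑ j, W i j * z j| := by rw [h1]
            _ ≤ ∑ j, |W i j * z j| := Finset.abs_sum_le_sum_abs _ _
            _ ≤ _ := by
              refine Finset.sum_le_sum fun j _ => ?_
              rw [abs_mul, hW, of_apply, abs_div, abs_of_nonneg (by positivity : 0 ≤ √(p i) * √(p j))]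
              calc |C i j| / (√(p i) * √(p j)) * |z j|
                  ≤ p i * (N + 1) i j / (√(p i) * √(p j)) * |z j| := by
                    have := hdom i j
                    gcongr
                _ = _ := by
                    rw [show p i * (N + 1) i j / (√(p i) * √(p j)) * |z j| =
                      p i / √(p i) * ((N + 1) i j * (|z j| / √(p j))) by ring, Real.div_sqrt]
        have h3 : l * (|z i| / √(p i)) ≤ ((N + 1) *ᵥ fun i => |z i| / √(p i)) i := by
          rw [← Finset.mul_sum] at h2
          rw [← mul_div_assoc, div_le_iff₀ hsi, mul_comm _ (√(p i))]
          exact h2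
        rw [add_mulVec, one_mulVec, Pi.add_apply] at h3
        linarith
    linarith
  have h1 := hpsd.dotProduct_mulVec_nonneg x
  rw [hBdef, sub_mulVec, smul_mulVec, one_mulVec, dotProduct_sub, dotProduct_smul] at h1
  simp only [star_trivial, smul_eq_mul, sub_nonneg] at h1
  calc _ = x ⬝ᵥ (W *ᵥ x) := by
        simp only [dotProduct, mulVec, Finset.mul_sum, hW, of_apply]
        exact Finset.sum_congr rfl fun i _ => Finset.sum_congr rfl fun j _ => by ring
    _ ≤ (1 + η) * (x ⬝ᵥ x) := h1
    _ = _ := by simp only [dotProduct, sq]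

end Perron

/-! ### Covariances, influences and the consequence of spectral independence. -/

section Covariance

variable {α : Type*} [Fintype α]

/-- Covariance of `f` and `g` under the probability weight `w`. -/
noncomputable def wcov (w f g : α → ℝ) : ℝ :=
  ∑ a, w a * f a * g a - (∑ a, w a * f a) * ∑ a, w a * g a

theorem wcov_comm (w f g : α → ℝ) : wcov w f g = wcov w g f := by
  simp only [wcov]
  rw [mul_comm (∑ a, w a * f a)]
  congr 1
  exact Finset.sum_congr rfl fun a _ => by ring

theorem wcov_sum_mul {ι : Type*} (s : Finset ι) (w f : α → ℝ) (c : ι → ℝ) (g : ι → α → ℝ) :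
    wcov w f (fun a => ∑ i ∈ s, c i * g i a) = ∑ i ∈ s, c i * wcov w f (g i) := by
  simp only [wcov, Finset.mul_sum, mul_sub, Finset.sum_sub_distrib]
  congr 1
  · rw [Finset.sum_comm]
    exact Finset.sum_congr rfl fun i _ => Finset.sum_congr rfl fun a _ => by ring
  · rw [Finset.sum_comm]
    exact Finset.sum_congr rfl fun i _ => Finset.sum_congr rfl fun a _ => by ring

theorem wcov_self {w : α → ℝ} (hw : ∑ a, w a = 1) (f : α → ℝ) : wcov w f f = wvar w f := by
  rw [wcov, wvar, hw, div_one, sq]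
  congr 1
  exact Finset.sum_congr rfl fun a _ => by ring

theorem wcov_eq_centered {w : α → ℝ} (hw : ∑ a, w a = 1) (f g : α → ℝ) :
    wcov w f g = ∑ a, w a * ((f a - ∑ b, w b * f b) * (g a - ∑ b, w b * g b)) := by
  set m := ∑ b, w b * f b with hm
  set m' := ∑ b, w b * g b with hm'
  have : ∀ a, w a * ((f a - m) * (g a - m')) =
      w a * f a * g a - m' * (w a * f a) - m * (w a * g a) + m * m' * w a := fun a => by ring
  simp only [this, Finset.sum_add_distrib, Finset.sum_sub_distrib, ← Finset.mul_sum, hw, ← hm,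
    ← hm', wcov]
  ring

theorem wcov_sq_le {w : α → ℝ} (hw : w ∈ stdSimplex ℝ α) (f g : α → ℝ) :
    wcov w f g ^ 2 ≤ wvar w f * wvar w g := by
  rw [← wcov_self hw.2, ← wcov_self hw.2, wcov_eq_centered hw.2, wcov_eq_centered hw.2,
    wcov_eq_centered hw.2]
  refine Finset.sum_sq_le_sum_mul_sum_of_sq_le_mul Finset.univ ?_ ?_ ?_
  · exact fun a _ => mul_nonneg (hw.1 a) (mul_self_nonneg _)
  · exact fun a _ => mul_nonneg (hw.1 a) (mul_self_nonneg _)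
  · exact fun a _ => le_of_eq (by ring)

/-- The differences sum to zero, so the one at `x` is at most the total absolute difference
elsewhere. -/
theorem abs_sub_le_tvDist [DecidableEq α] {f g : α → ℝ} (h : ∑ x, f x = ∑ x, g x) (x : α) :
    |f x - g x| ≤ tvDist f g := by
  have h0 : (f x - g x) + ∑ y ∈ Finset.univ.erase x, (f y - g y) = 0 := by
    rw [Finset.add_sum_erase Finset.univ (fun y => f y - g y) (Finset.mem_univ x),
      Finset.sum_sub_distrib, h, sub_self]
  have h1 : |f x - g x| ≤ ∑ y ∈ Finset.univ.erase x, |f y - g y| := by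
    rw [eq_neg_of_add_eq_zero_left h0, abs_neg]
    exact Finset.abs_sum_le_sum_abs _ _
  rw [tvDist, ← Finset.add_sum_erase Finset.univ (fun y => |f y - g y|) (Finset.mem_univ x)]
  linarith

end Covariance

variable {V : Type*} [Fintype V] [DecidableEq V]

/-- The indicator of the spin at `v` being `+1`. -/
def plusInd (v : V) (σ : Config V) : ℝ := if σ v = 1 then 1 else 0

omit [Fintype V] [DecidableEq V] in
theorem restrict_singleton_eq_iff (u : V) (σ : Config V) (s : ({u} : Finset V) → ℤˣ) :
    ({u} : Finset V).restrict σ = s ↔ σ u = s ⟨u, Finset.mem_singleton_self u⟩ := by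
  constructor
  · rintro rfl
    rfl
  · intro h
    ext1 ⟨w, hw⟩
    obtain rfl := Finset.mem_singleton.mp hw
    exact h

theorem marginal_singleton (ν : Config V → ℝ) (u : V) (c : ℤˣ) :
    marginal ν {u} (fun _ => c) = ∑ σ, if σ u = c then ν σ else 0 := by
  simp only [marginal, restrict_singleton_eq_iff, Finset.sum_filter]

theorem sum_marginal (ν : Config V → ℝ) (Λ : Finset V) :
    ∑ s, marginal ν Λ s = ∑ σ, ν σ := by
  simp only [marginal]
  exact Finset.sum_fiberwise Finset.univ Λ.restrict ν

theorem influence_nonneg (ν : Config V → ℝ) (u v : V) : 0 ≤ influence ν u v :=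
  Real.iSup_nonneg fun _ => mul_nonneg (by norm_num) (Finset.sum_nonneg fun _ _ => abs_nonneg _)

/-- With `p`, `q` the probabilities of `+1` and `-1` at `u`, the covariance is `p * q` times the
difference of the two conditional probabilities of `+1` at `v`. The influence bounds that
difference, and `q ≤ 1` is dropped. -/
theorem abs_wcov_plusInd_le {ν : Config V → ℝ} (hν : ν ∈ stdSimplex ℝ (Config V)) (u v : V) :
    |wcov ν (plusInd u) (plusInd v)| ≤ (∑ σ, ν σ * plusInd u σ) * influence ν u v := by
  set p := ∑ σ, ν σ * plusInd u σ with hp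
  set q := ∑ σ, ν σ * (1 - plusInd u σ) with hq
  set a := ∑ σ, ν σ * plusInd u σ * plusInd v σ with ha
  set b := ∑ σ, ν σ * (1 - plusInd u σ) * plusInd v σ with hb
  have hi01 : ∀ w σ, 0 ≤ plusInd (V := V) w σ ∧ plusInd w σ ≤ 1 := by
    intro w σ
    rw [plusInd]
    split_ifs <;> norm_num
  have hpq : p + q = 1 := by
    rw [hp, hq, ← Finset.sum_add_distrib]
    refine Eq.trans ?_ hν.2
    exact Finset.sum_congr rfl fun σ _ => by ring
  have hab : ∑ σ, ν σ * plusInd v σ = a + b := by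
    rw [ha, hb, ← Finset.sum_add_distrib]
    exact Finset.sum_congr rfl fun σ _ => by ring
  have ha0 : 0 ≤ a := Finset.sum_nonneg fun σ _ =>
    mul_nonneg (mul_nonneg (hν.1 σ) (hi01 u σ).1) (hi01 v σ).1
  have hb0 : 0 ≤ b := Finset.sum_nonneg fun σ _ =>
    mul_nonneg (mul_nonneg (hν.1 σ) (sub_nonneg.mpr (hi01 u σ).2)) (hi01 v σ).1
  have hap : a ≤ p := Finset.sum_le_sum fun σ _ =>
    mul_le_of_le_one_right (mul_nonneg (hν.1 σ) (hi01 u σ).1) (hi01 v σ).2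
  have hbq : b ≤ q := Finset.sum_le_sum fun σ _ =>
    mul_le_of_le_one_right (mul_nonneg (hν.1 σ) (sub_nonneg.mpr (hi01 u σ).2)) (hi01 v σ).2
  have hcov : wcov ν (plusInd u) (plusInd v) = a * q - p * b := by
    rw [wcov, hab, ← hp, ← ha, eq_sub_of_add_eq' hpq]
    ring
  rw [hcov]
  have hinf := influence_nonneg ν u v
  rcases (ha0.trans hap).eq_or_lt with h0 | hppos
  · have : a = 0 := by linarith
    rw [← h0, this]
    simp
  rcases (hb0.trans hbq).eq_or_lt with h0 | hqpos
  · have : b = 0 := by linarith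
    rw [← h0, this]
    simp only [mul_zero, sub_zero, abs_zero]
    positivity
  have hm1 : marginal ν {u} (fun _ => 1) = p := by
    rw [marginal_singleton, hp]
    refine Finset.sum_congr rfl fun σ _ => ?_
    simp [plusInd]
  have hm2 : marginal ν {u} (fun _ => -1) = q := by
    rw [marginal_singleton, hq]
    refine Finset.sum_congr rfl fun σ _ => ?_
    rcases Int.units_eq_one_or (σ u) with h | h <;> simp [plusInd, h]
  have hs1 : (fun _ => 1) ∈ supp (marginal ν {u}) := by simp [supp, hm1, hppos.ne']
  have hs2 : (fun _ => -1) ∈ supp (marginal ν {u}) := by simp [supp, hm2, hqpos.ne']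
  have hc1 : marginal (pinned ν {u} fun _ => 1) {v} (fun _ => 1) = a / p := by
    rw [marginal_singleton, ha, Finset.sum_div]
    refine Finset.sum_congr rfl fun σ _ => ?_
    rw [pinned, hm1]
    simp only [restrict_singleton_eq_iff, plusInd]
    split_ifs <;> simp
  have hc2 : marginal (pinned ν {u} fun _ => -1) {v} (fun _ => 1) = b / q := by
    rw [marginal_singleton, hb, Finset.sum_div]
    refine Finset.sum_congr rfl fun σ _ => ?_
    rw [pinned, hm2]
    simp only [restrict_singleton_eq_iff, plusInd]
    rcases Int.units_eq_one_or (σ u) with h | h <;> simp [h, ite_div]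
  have htv : |a / p - b / q| ≤ influence ν u v := by
    rw [← hc1, ← hc2]
    refine (abs_sub_le_tvDist ?_ _).trans
      (le_ciSup (f := fun p : supp (marginal ν {u}) × supp (marginal ν {u}) =>
        tvDist (marginal (pinned ν {u} p.1) {v}) (marginal (pinned ν {u} p.2) {v}))
        (Set.finite_range _).bddAbove (⟨_, hs1⟩, ⟨_, hs2⟩))
    rw [sum_marginal, sum_marginal, (pinned_mem_stdSimplex hν.1 hs1).2,
      (pinned_mem_stdSimplex hν.1 hs2).2]
  have hfac : a * q - p * b = p * q * (a / p - b / q) := by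
    field_simp
  rw [hfac, abs_mul, abs_of_pos (mul_pos hppos hqpos)]
  calc p * q * |a / p - b / q| ≤ p * q * influence ν u v := by gcongr
    _ ≤ p * 1 * influence ν u v := by
        gcongr
        linarith
    _ = _ := by ring

/-- Spectral independence bounds the total squared correlation of a function with the spins. -/
theorem sum_wcov_sq_div_le {μ : Config V → ℝ} (h0 : ∀ σ, 0 ≤ μ σ) {Λ : Finset V} {s : Λ → ℤˣ}
    (hs : s ∈ supp (marginal μ Λ)) {η : ℝ} (hη : 0 ≤ η) (hSI : SpectrallyIndependent μ η)
    (f : Config V → ℝ) :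
    ∑ v ∈ Λᶜ, wcov (pinned μ Λ s) f (plusInd v) ^ 2 / ∑ σ, pinned μ Λ s σ * plusInd v σ ≤
      (1 + η) * wvar (pinned μ Λ s) f := by
  set ν := pinned μ Λ s with hνdef
  have hν : ν ∈ stdSimplex ℝ (Config V) := pinned_mem_stdSimplex h0 hs
  set p : {v // v ∉ Λ} → ℝ := fun v => ∑ σ, ν σ * plusInd v.1 σ with hp
  have hp0 : ∀ v, 0 ≤ p v := fun v => Finset.sum_nonneg fun σ _ => mul_nonneg (hν.1 σ) (by
    rw [plusInd]; split_ifs <;> norm_num)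
  have hconv : ∑ v ∈ Λᶜ, wcov ν f (plusInd v) ^ 2 / ∑ σ, ν σ * plusInd v σ =
      ∑ v : {v // v ∉ Λ}, wcov ν f (plusInd v.1) ^ 2 / p v :=
    Finset.sum_subtype _ (fun v => by simp) _
  rw [hconv]
  -- The diagonal bound `Var ≤ p` is the source of the `1` in `1 + η`.
  have hdiag : ∀ v : V, |wcov ν (plusInd v) (plusInd v)| ≤ ∑ σ, ν σ * plusInd v σ := by
    intro v
    rw [wcov_self hν.2, abs_of_nonneg (wvar_nonneg hν.1 _), wvar, hν.2, div_one]
    have : ∀ σ, ν σ * plusInd v σ ^ 2 = ν σ * plusInd v σ := by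
      intro σ
      rw [plusInd]
      split_ifs <;> norm_num
    simp only [this]
    linarith [sq_nonneg (∑ σ, ν σ * plusInd v σ)]
  have hquad := quadratic_le_of_dominated (N := influenceMatrix μ Λ s)
    (C := Matrix.of fun u v : {v // v ∉ Λ} => wcov ν (plusInd u.1) (plusInd v.1))
    (fun u v => by
      rw [influenceMatrix, of_apply]
      split_ifs
      · exact le_rfl
      · exact influence_nonneg _ _ _)
    hη (hSI Λ s hs) hp0 (fun u v => wcov_comm _ _ _)
    (fun u v => by
      rw [of_apply, influenceMatrix, Matrix.add_apply, of_apply, one_apply]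
      by_cases huv : u = v
      · subst huv
        simpa using hdiag u
      · rw [if_neg huv, if_neg huv, add_zero]
        exact abs_wcov_plusInd_le hν u v)
    (fun v => wcov ν f (plusInd v.1) / √(p v))
  set x : {v // v ∉ Λ} → ℝ := fun v => wcov ν f (plusInd v.1) / √(p v) with hx
  have hxsq : ∀ v, x v ^ 2 = wcov ν f (plusInd v.1) ^ 2 / p v := fun v => by
    rw [hx, div_pow, Real.sq_sqrt (hp0 v)]
  -- Dual test function: `Cov(f, g) = ∑ x v ^ 2 = X`, while `Var g` is the quadratic form at `x`, at
  -- most `(1 + η) X`. Cauchy–Schwarz gives `X² ≤ (1 + η) X * Var f`.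
  set g : Config V → ℝ := fun σ => ∑ v, (x v / √(p v)) * plusInd (v : {v // v ∉ Λ}).1 σ with hg
  have hcovfg : wcov ν f g = ∑ v, x v ^ 2 := by
    rw [hg, wcov_sum_mul]
    refine Finset.sum_congr rfl fun v _ => ?_
    rw [hx]
    ring
  have hvarg : wvar ν g = ∑ u, ∑ v, wcov ν (plusInd u.1) (plusInd v.1) /
      (√(p u) * √(p v)) * x u * x v := by
    rw [← wcov_self hν.2]
    refine (wcov_sum_mul Finset.univ ν g _ _).trans (Finset.sum_congr rfl fun u _ => ?_)
    rw [wcov_comm, hg, wcov_sum_mul, Finset.mul_sum]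
    refine Finset.sum_congr rfl fun v _ => ?_
    ring
  simp only [of_apply] at hquad
  rw [← hvarg] at hquad
  simp only [← hxsq]
  set X := ∑ v, x v ^ 2 with hX
  have hX0 : 0 ≤ X := Finset.sum_nonneg fun v _ => sq_nonneg _
  have hCS := wcov_sq_le hν f g
  rw [hcovfg] at hCS
  have hvf := wvar_nonneg hν.1 f
  rcases hX0.eq_or_lt with h | h
  · rw [← h]
    positivity
  · have : X * X ≤ (1 + η) * wvar ν f * X := by
      nlinarith [mul_le_mul_of_nonneg_left hquad hvf]
    exact le_of_mul_le_mul_right this h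

end SpinDistribution

namespace SpinDistribution

/-! ### The field dynamics: revealing `+1` spins and the evolution of conditional variance. -/

section Flow

variable {V : Type*} [Fintype V] [DecidableEq V]

/-- The set of vertices with spin `+1`. -/
def plusSet (σ : Config V) : Finset V := Finset.univ.filter fun v => σ v = 1

omit [DecidableEq V] in
theorem mem_plusSet {σ : Config V} {v : V} : v ∈ plusSet σ ↔ σ v = 1 := by simp [plusSet]

/-- The weight of the magnetized distribution `μ^{(t)}` restricted to the configurations that are
`+1` on `R`, where the vertices of `R` do not contribute to the field. -/
def plusWeight (μ : Config V → ℝ) (t : ℝ) (R : Finset V) (σ : Config V) : ℝ :=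
  if R ⊆ plusSet σ then μ σ * t ^ (plusSet σ \ R).card else 0

variable {μ : Config V → ℝ}

theorem plusWeight_nonneg (h0 : ∀ σ, 0 ≤ μ σ) {t : ℝ} (ht : 0 ≤ t) (R : Finset V) (σ : Config V) :
    0 ≤ plusWeight μ t R σ := by
  rw [plusWeight]
  split_ifs
  · exact mul_nonneg (h0 σ) (pow_nonneg ht _)
  · exact le_rfl

theorem plusWeight_mul_plusInd (t : ℝ) {R : Finset V} {v : V} (hv : v ∉ R) (σ : Config V) :
    plusWeight μ t R σ * plusInd v σ = t * plusWeight μ t (insert v R) σ := by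
  simp only [plusWeight, plusInd, Finset.insert_subset_iff, mem_plusSet]
  by_cases h1 : σ v = 1
  · by_cases h2 : R ⊆ plusSet σ
    · have hcard : (plusSet σ \ insert v R).card + 1 = (plusSet σ \ R).card := by
        rw [Finset.sdiff_insert]
        exact Finset.card_erase_add_one (Finset.mem_sdiff.mpr ⟨mem_plusSet.mpr h1, hv⟩)
      rw [if_pos h1, if_pos h2, if_pos ⟨h1, h2⟩, ← hcard]
      ring
    · simp [h2]
  · simp [h1]

/-- The factor `k` in the derivative of `t ^ k` counts the unrevealed `+1` vertices, giving one
summand for each. -/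
theorem hasDerivAt_plusWeight (t : ℝ) (R : Finset V) (σ : Config V) :
    HasDerivAt (fun t => plusWeight μ t R σ) (∑ v ∈ Rᶜ, plusWeight μ t (insert v R) σ) t := by
  by_cases h : R ⊆ plusSet σ
  · have hcard : ∀ v ∈ plusSet σ \ R,
        (plusSet σ \ insert v R).card = (plusSet σ \ R).card - 1 := by
      intro v hv
      rw [Finset.sdiff_insert, Finset.card_erase_of_mem hv]
    have hsum : ∑ v ∈ Rᶜ, plusWeight μ t (insert v R) σ =
        μ σ * ((plusSet σ \ R).card * t ^ ((plusSet σ \ R).card - 1)) := by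
      rw [← Finset.sum_subset (s₁ := plusSet σ \ R)]
      · rw [Finset.sum_congr rfl fun v hv => show _ =
          μ σ * t ^ ((plusSet σ \ R).card - 1) by
            rw [plusWeight, if_pos (Finset.insert_subset (Finset.mem_sdiff.mp hv).1 h),
              hcard v hv], Finset.sum_const, nsmul_eq_mul]
        ring
      · intro v hv
        exact Finset.mem_compl.mpr (Finset.mem_sdiff.mp hv).2
      · intro v hv hv'
        rw [plusWeight, if_neg]
        intro hins
        exact hv' (Finset.mem_sdiff.mpr
          ⟨hins (Finset.mem_insert_self v R), Finset.mem_compl.mp hv⟩)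
    rw [hsum]
    simp only [plusWeight, if_pos h]
    exact (hasDerivAt_pow _ t).const_mul (μ σ)
  · have hsum : ∑ v ∈ Rᶜ, plusWeight μ t (insert v R) σ = 0 :=
      Finset.sum_eq_zero fun v _ => by
        rw [plusWeight, if_neg fun hins => h ((Finset.subset_insert v R).trans hins)]
    rw [hsum]
    simp only [plusWeight, if_neg h]
    exact hasDerivAt_const t 0

/-- The binomial theorem on subsets of `plusSet σ`, with `(1 - t) + t = 1`. -/
theorem sum_pow_mul_plusWeight (t : ℝ) (σ : Config V) :
    ∑ R, (1 - t) ^ R.card * plusWeight μ t R σ = μ σ := by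
  have h1 : ∑ R, (1 - t) ^ R.card * plusWeight μ t R σ =
      ∑ R ∈ (plusSet σ).powerset, (1 - t) ^ R.card * plusWeight μ t R σ := by
    refine (Finset.sum_subset (Finset.subset_univ _) fun R _ hR => ?_).symm
    rw [plusWeight, if_neg fun h => hR (Finset.mem_powerset.mpr h), mul_zero]
  rw [h1, Finset.sum_congr rfl fun R hR => show _ =
    μ σ * ((1 - t) ^ R.card * t ^ ((plusSet σ).card - R.card)) by
      have h := Finset.mem_powerset.mp hR
      rw [plusWeight, if_pos h, Finset.card_sdiff_of_subset h]
      ring, ← Finset.mul_sum, Finset.sum_pow_mul_eq_add_pow]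
  simp

theorem plusWeight_one_empty : plusWeight μ 1 ∅ = μ := by
  ext σ
  simp [plusWeight]

/-- `∑ σ, plusWeight μ t R σ * F σ`. -/
noncomputable def plusSum (μ : Config V → ℝ) (F : Config V → ℝ) (t : ℝ) (R : Finset V) : ℝ :=
  ∑ σ, plusWeight μ t R σ * F σ

theorem hasDerivAt_plusSum (F : Config V → ℝ) (t : ℝ) (R : Finset V) :
    HasDerivAt (fun t => plusSum μ F t R) (∑ v ∈ Rᶜ, plusSum μ F t (insert v R)) t := by
  have h : ∑ v ∈ Rᶜ, plusSum μ F t (insert v R) =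
      ∑ σ, (∑ v ∈ Rᶜ, plusWeight μ t (insert v R) σ) * F σ := by
    simp only [plusSum, Finset.sum_mul]
    exact Finset.sum_comm
  rw [h]
  exact HasDerivAt.fun_sum fun σ _ => (hasDerivAt_plusWeight t R σ).mul_const (F σ)

theorem plusSum_one_eq (t : ℝ) (R : Finset V) :
    plusSum μ (fun _ => 1) t R = ∑ σ, plusWeight μ t R σ := by simp [plusSum]

/-- Zero mass at one positive `t` means that `μ` vanishes on all configurations that are `+1` on
`R`, a fact independent of `t` and inherited by larger sets. This settles the divisions by zero
below. -/
theorem plusWeight_eq_zero (h0 : ∀ σ, 0 ≤ μ σ) {t : ℝ} (ht : 0 < t) {R : Finset V}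
    (hZ : plusSum μ (fun _ => 1) t R = 0) {R' : Finset V} (hR : R ⊆ R') (t' : ℝ) (σ : Config V) :
    plusWeight μ t' R' σ = 0 := by
  rw [plusSum_one_eq, Finset.sum_eq_zero_iff_of_nonneg fun σ _ =>
    plusWeight_nonneg h0 ht.le R σ] at hZ
  have h := hZ σ (Finset.mem_univ σ)
  rw [plusWeight] at h ⊢
  split_ifs with h1
  · rw [if_pos (hR.trans h1)] at h
    rcases mul_eq_zero.mp h with h2 | h2
    · rw [h2, zero_mul]
    · exact absurd h2 (pow_pos ht _).ne'
  · rfl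

theorem plusSum_eq_zero (h0 : ∀ σ, 0 ≤ μ σ) {t : ℝ} (ht : 0 < t) {R : Finset V}
    (hZ : plusSum μ (fun _ => 1) t R = 0) {R' : Finset V} (hR : R ⊆ R') (F : Config V → ℝ)
    (t' : ℝ) : plusSum μ F t' R' = 0 :=
  Finset.sum_eq_zero fun σ _ => by rw [plusWeight_eq_zero h0 ht hZ hR, zero_mul]

theorem wvar_plusWeight (t : ℝ) (R : Finset V) (f : Config V → ℝ) :
    wvar (plusWeight μ t R) f = plusSum μ (fun σ => f σ ^ 2) t R -
      plusSum μ f t R ^ 2 / plusSum μ (fun _ => 1) t R := by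
  rw [plusSum_one_eq]
  rfl

theorem hasDerivAt_sq_div_plusSum (h0 : ∀ σ, 0 ≤ μ σ) (f : Config V → ℝ) {t : ℝ} (ht : 0 < t)
    (R : Finset V) :
    HasDerivAt (fun t => plusSum μ f t R ^ 2 / plusSum μ (fun _ => 1) t R)
      (∑ v ∈ Rᶜ, (2 * plusSum μ f t R * plusSum μ f t (insert v R) / plusSum μ (fun _ => 1) t R -
        plusSum μ f t R ^ 2 * plusSum μ (fun _ => 1) t (insert v R) /
          plusSum μ (fun _ => 1) t R ^ 2)) t := by
  by_cases hZ : plusSum μ (fun _ => 1) t R = 0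
  · have h1 : (fun t => plusSum μ f t R ^ 2 / plusSum μ (fun _ => 1) t R) = fun _ => 0 := by
      ext t'
      rw [plusSum_eq_zero h0 ht hZ (Finset.Subset.refl R) (fun _ => 1) t', div_zero]
    rw [h1, hZ]
    simpa using hasDerivAt_const t (0 : ℝ)
  · have h1 := ((hasDerivAt_plusSum (μ := μ) f t R).fun_pow 2).fun_div
      (hasDerivAt_plusSum (μ := μ) (fun _ => 1) t R) hZ
    refine h1.congr_deriv ?_
    rw [Finset.sum_sub_distrib, ← Finset.sum_div, ← Finset.sum_div, ← Finset.mul_sum,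
      ← Finset.mul_sum]
    field_simp
    push_cast
    ring

/-- Reindexes by `S = insert v R`: a set with a last revealed vertex is a set with a next vertex to
reveal. -/
theorem sum_sum_mem_eq_sum_sum_compl (G : Finset V → V → ℝ) :
    ∑ S : Finset V, ∑ v ∈ S, G (S.erase v) v = ∑ R : Finset V, ∑ v ∈ Rᶜ, G R v := by
  rw [Finset.sum_sigma', Finset.sum_sigma']
  refine Finset.sum_bij' (fun p _ => ⟨p.1.erase p.2, p.2⟩) (fun p _ => ⟨insert p.2 p.1, p.2⟩)
    ?_ ?_ ?_ ?_ ?_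
  · rintro ⟨S, v⟩ h
    simp
  · rintro ⟨S, v⟩ h
    simp
  · rintro ⟨S, v⟩ h
    simp only [Finset.mem_sigma, Finset.mem_univ, true_and] at h
    simp [Finset.insert_erase h]
  · rintro ⟨S, v⟩ h
    simp only [Finset.mem_sigma, Finset.mem_univ, true_and, Finset.mem_compl] at h
    simp [Finset.erase_insert h]
  · rintro ⟨S, v⟩ h
    rfl

/-- The squared change of the conditional mean of `f` when the spin at `v` is revealed to be `+1`,
weighted by the rate of this event. -/
noncomputable def revealTerm (μ f : Config V → ℝ) (t : ℝ) (R : Finset V) (v : V) : ℝ :=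
  plusSum μ f t (insert v R) ^ 2 / plusSum μ (fun _ => 1) t (insert v R) -
    (2 * plusSum μ f t R * plusSum μ f t (insert v R) / plusSum μ (fun _ => 1) t R -
      plusSum μ f t R ^ 2 * plusSum μ (fun _ => 1) t (insert v R) /
        plusSum μ (fun _ => 1) t R ^ 2)

/-- The expected conditional variance of `f` given a random set of revealed `+1` spins, each of
which is revealed independently with probability `1 - t`. -/
noncomputable def expectedVar (μ f : Config V → ℝ) (t : ℝ) : ℝ :=
  ∑ R : Finset V, (1 - t) ^ R.card * wvar (plusWeight μ t R) f

/-- The mixture identity makes the expected second moment independent of `t`; only the squared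
conditional means evolve. -/
theorem expectedVar_eq (f : Config V → ℝ) (t : ℝ) :
    expectedVar μ f t = ∑ σ, μ σ * f σ ^ 2 -
      ∑ R : Finset V, (1 - t) ^ R.card * (plusSum μ f t R ^ 2 / plusSum μ (fun _ => 1) t R) := by
  simp only [expectedVar, wvar_plusWeight, mul_sub, Finset.sum_sub_distrib]
  congr 1
  simp only [plusSum, Finset.mul_sum]
  rw [Finset.sum_comm]
  refine Finset.sum_congr rfl fun σ _ => ?_
  rw [← sum_pow_mul_plusWeight (μ := μ) t σ, Finset.sum_mul]
  exact Finset.sum_congr rfl fun R _ => by ring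

/-- Differentiating `(1 - t) ^ |S|` gives `|S|` equal terms, one for each choice of last revealed `v
∈ S`. Moved to `R = S.erase v`, they complete the derivatives of the quotients to `Z_{R∪v} *
(m_{R∪v} - m_R)²`, where `Z` is mass and `m` conditional mean; this is `revealTerm`. -/
theorem hasDerivAt_expectedVar (h0 : ∀ σ, 0 ≤ μ σ) (f : Config V → ℝ) {t : ℝ} (ht : 0 < t) :
    HasDerivAt (expectedVar μ f)
      (∑ R : Finset V, (1 - t) ^ R.card * ∑ v ∈ Rᶜ, revealTerm μ f t R v) t := by
  have hfun : expectedVar μ f = fun t => ∑ σ, μ σ * f σ ^ 2 -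
      ∑ R : Finset V, (1 - t) ^ R.card * (plusSum μ f t R ^ 2 / plusSum μ (fun _ => 1) t R) :=
    funext fun t => expectedVar_eq f t
  rw [hfun]
  have hpow : ∀ R : Finset V, HasDerivAt (fun t : ℝ => (1 - t) ^ R.card)
      (-(R.card * (1 - t) ^ (R.card - 1))) t := by
    intro R
    simpa using ((hasDerivAt_id t).const_sub 1).fun_pow R.card
  have h1 := (HasDerivAt.fun_sum fun R (_ : R ∈ (Finset.univ : Finset (Finset V))) =>
    (hpow R).fun_mul (hasDerivAt_sq_div_plusSum h0 f ht R)).const_sub (∑ σ, μ σ * f σ ^ 2)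
  refine h1.congr_deriv ?_
  have h2 : ∑ R : Finset V, ∑ v ∈ Rᶜ, (1 - t) ^ R.card *
      (plusSum μ f t (insert v R) ^ 2 / plusSum μ (fun _ => 1) t (insert v R)) =
      ∑ R : Finset V, (R.card * (1 - t) ^ (R.card - 1)) *
        (plusSum μ f t R ^ 2 / plusSum μ (fun _ => 1) t R) := by
    rw [← sum_sum_mem_eq_sum_sum_compl]
    refine Finset.sum_congr rfl fun S _ => ?_
    rw [Finset.sum_congr rfl fun v hv => show _ = (1 - t) ^ (S.card - 1) *
      (plusSum μ f t S ^ 2 / plusSum μ (fun _ => 1) t S) by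
        rw [Finset.insert_erase hv, Finset.card_erase_of_mem hv], Finset.sum_const, nsmul_eq_mul]
    ring
  have h3 : ∀ R : Finset V, (1 - t) ^ R.card * ∑ v ∈ Rᶜ, revealTerm μ f t R v =
      ∑ v ∈ Rᶜ, (1 - t) ^ R.card *
        (plusSum μ f t (insert v R) ^ 2 / plusSum μ (fun _ => 1) t (insert v R)) -
      (1 - t) ^ R.card * ∑ v ∈ Rᶜ, (2 * plusSum μ f t R * plusSum μ f t (insert v R) /
        plusSum μ (fun _ => 1) t R - plusSum μ f t R ^ 2 *
          plusSum μ (fun _ => 1) t (insert v R) / plusSum μ (fun _ => 1) t R ^ 2) := by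
    intro R
    rw [← Finset.mul_sum, ← mul_sub, ← Finset.sum_sub_distrib]
    rfl
  simp only [h3]
  rw [Finset.sum_sub_distrib, h2, Finset.sum_add_distrib]
  simp only [neg_mul, Finset.sum_neg_distrib]
  ring

/-! ### Identification with pinnings of magnetized distributions, and the two main estimates. -/

omit [DecidableEq V] in
theorem fieldWeight_const (t : ℝ) (σ : Config V) :
    fieldWeight μ (fun _ => t) σ = μ σ * t ^ (plusSet σ).card := by
  rw [fieldWeight, Finset.prod_const, plusSet]

theorem sum_fieldWeight_pos (hμ : μ ∈ stdSimplex ℝ (Config V)) {t : ℝ} (ht : 0 < t) :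
    0 < ∑ σ, fieldWeight μ (fun _ => t) σ := by
  obtain ⟨τ, hτ⟩ : ∃ τ, μ τ ≠ 0 := by
    by_contra! h
    have := hμ.2
    simp [h] at this
  simp only [fieldWeight_const]
  refine Finset.sum_pos' (fun σ _ => mul_nonneg (hμ.1 σ) (pow_pos ht _).le)
    ⟨τ, Finset.mem_univ τ, mul_pos (lt_of_le_of_ne (hμ.1 τ) hτ.symm) (pow_pos ht _)⟩

theorem magnetize_mem_stdSimplex (hμ : μ ∈ stdSimplex ℝ (Config V)) {t : ℝ} (ht : 0 < t) :
    magnetize μ (fun _ => t) ∈ stdSimplex ℝ (Config V) := by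
  have hZ := sum_fieldWeight_pos hμ ht
  constructor
  · intro σ
    refine div_nonneg ?_ hZ.le
    rw [fieldWeight_const]
    exact mul_nonneg (hμ.1 σ) (pow_pos ht _).le
  · simp only [magnetize]
    rw [← Finset.sum_div, div_self hZ.ne']

omit [DecidableEq V] in
theorem restrict_eq_one_iff (R : Finset V) (σ : Config V) :
    R.restrict σ = (fun _ => 1) ↔ R ⊆ plusSet σ := by
  rw [funext_iff]
  exact ⟨fun h v hv => mem_plusSet.mpr (h ⟨v, hv⟩), fun h v => (mem_plusSet (σ := σ)).mp (h v.2)⟩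

theorem ite_magnetize (t : ℝ) (R : Finset V) (σ : Config V) :
    (if R.restrict σ = (fun _ => 1) then magnetize μ (fun _ => t) σ else 0) =
      t ^ R.card / (∑ τ, fieldWeight μ (fun _ => t) τ) * plusWeight μ t R σ := by
  simp only [restrict_eq_one_iff, plusWeight]
  split_ifs with h
  · rw [magnetize, fieldWeight_const, ← Finset.card_sdiff_add_card_eq_card h, pow_add]
    ring
  · rw [mul_zero]

theorem marginal_magnetize (t : ℝ) (R : Finset V) :
    marginal (magnetize μ fun _ => t) R (fun _ => 1) =
      t ^ R.card / (∑ τ, fieldWeight μ (fun _ => t) τ) * plusSum μ (fun _ => 1) t R := by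
  rw [marginal, Finset.sum_filter, plusSum_one_eq, Finset.mul_sum]
  exact Finset.sum_congr rfl fun σ _ => ite_magnetize t R σ

theorem one_mem_supp_marginal_magnetize (hμ : μ ∈ stdSimplex ℝ (Config V)) {t : ℝ} (ht : 0 < t)
    {R : Finset V} (hZ : plusSum μ (fun _ => 1) t R ≠ 0) :
    (fun _ => 1) ∈ supp (marginal (magnetize μ fun _ => t) R) := by
  simp only [supp, Finset.mem_filter, Finset.mem_univ, true_and, marginal_magnetize]
  have := sum_fieldWeight_pos hμ ht
  positivity

/-- The constant field factor `t ^ |R|` of the pinned vertices cancels under conditioning. -/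
theorem plusWeight_eq_mul_pinned (hμ : μ ∈ stdSimplex ℝ (Config V)) {t : ℝ} (ht : 0 < t)
    {R : Finset V} (hZ : plusSum μ (fun _ => 1) t R ≠ 0) :
    plusWeight μ t R = fun σ => plusSum μ (fun _ => 1) t R *
      pinned (magnetize μ fun _ => t) R (fun _ => 1) σ := by
  ext σ
  have h1 := sum_fieldWeight_pos hμ ht
  have h2 : pinned (magnetize μ fun _ => t) R (fun _ => 1) σ =
      (if R.restrict σ = (fun _ => 1) then magnetize μ (fun _ => t) σ else 0) /
        marginal (magnetize μ fun _ => t) R (fun _ => 1) := by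
    rw [pinned]
    split_ifs <;> simp
  rw [h2, ite_magnetize, marginal_magnetize]
  field_simp

variable {η : ℝ}

theorem sum_revealTerm_le (hμ : μ ∈ stdSimplex ℝ (Config V)) (hη : 0 ≤ η) {t : ℝ} (ht : 0 < t)
    (hSI : SpectrallyIndependent (magnetize μ fun _ => t) η) (f : Config V → ℝ) (R : Finset V) :
    t * ∑ v ∈ Rᶜ, revealTerm μ f t R v ≤ (1 + η) * wvar (plusWeight μ t R) f := by
  have hw := plusWeight_nonneg hμ.1 ht.le R
  by_cases hZ : plusSum μ (fun _ => 1) t R = 0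
  · have : ∑ v ∈ Rᶜ, revealTerm μ f t R v = 0 := Finset.sum_eq_zero fun v _ => by
      rw [revealTerm, hZ, plusSum_eq_zero hμ.1 ht hZ (Finset.subset_insert v R)]
      simp
    rw [this, mul_zero]
    exact mul_nonneg (by linarith) (wvar_nonneg hw f)
  have hZ0 : 0 ≤ plusSum μ (fun _ => 1) t R := by
    rw [plusSum_one_eq]
    exact Finset.sum_nonneg fun σ _ => hw σ
  have hν := plusWeight_eq_mul_pinned hμ ht hZ
  have hmain := sum_wcov_sq_div_le (magnetize_mem_stdSimplex hμ ht).1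
    (one_mem_supp_marginal_magnetize hμ ht hZ) hη hSI f
  set ν := pinned (magnetize μ fun _ => t) R (fun _ => 1) with hνdef
  set Z := plusSum μ (fun _ => 1) t R with hZdef
  have hνw : ∀ σ, ν σ = plusWeight μ t R σ / Z := fun σ => by
    rw [hν]
    field_simp
  have hp : ∀ v ∈ Rᶜ, ∑ σ, ν σ * plusInd v σ = t * plusSum μ (fun _ => 1) t (insert v R) / Z := by
    intro v hv
    rw [plusSum_one_eq, Finset.mul_sum, Finset.sum_div]
    refine Finset.sum_congr rfl fun σ _ => ?_
    rw [← plusWeight_mul_plusInd t (Finset.mem_compl.mp hv), hνw]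
    ring
  have hf : ∑ σ, ν σ * f σ = plusSum μ f t R / Z := by
    rw [plusSum, Finset.sum_div]
    refine Finset.sum_congr rfl fun σ _ => ?_
    rw [hνw]
    ring
  have hfp : ∀ v ∈ Rᶜ, ∑ σ, ν σ * f σ * plusInd v σ = t * plusSum μ f t (insert v R) / Z := by
    intro v hv
    rw [plusSum, Finset.mul_sum, Finset.sum_div]
    refine Finset.sum_congr rfl fun σ _ => ?_
    rw [← mul_assoc, ← plusWeight_mul_plusInd t (Finset.mem_compl.mp hv), hνw]
    ring
  -- Conditioning on `+1` at `v` shifts the mean of `f` by `Cov(f, plusInd v) / p_v`, with `p_v = t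
  -- Z_{R∪v} / Z`. If `v` cannot be `+1`, both sides are zero.
  have hterm : ∀ v ∈ Rᶜ, t * revealTerm μ f t R v =
      Z * (wcov ν f (plusInd v) ^ 2 / ∑ σ, ν σ * plusInd v σ) := by
    intro v hv
    rw [wcov, hfp v hv, hf, hp v hv, revealTerm, ← hZdef]
    by_cases hZv : plusSum μ (fun _ => 1) t (insert v R) = 0
    · rw [hZv, plusSum_eq_zero hμ.1 ht hZv (Finset.Subset.refl _) f t]
      simp
    · field_simp
      ring
  calc t * ∑ v ∈ Rᶜ, revealTerm μ f t R v
      = Z * ∑ v ∈ Rᶜ, wcov ν f (plusInd v) ^ 2 / ∑ σ, ν σ * plusInd v σ := by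
        rw [Finset.mul_sum, Finset.mul_sum]
        exact Finset.sum_congr rfl hterm
    _ ≤ Z * ((1 + η) * wvar ν f) := mul_le_mul_of_nonneg_left hmain hZ0
    _ = (1 + η) * wvar (plusWeight μ t R) f := by
        rw [hν, wvar_smul]
        ring

/-- Approximate conservation of variance along the field dynamics. -/
theorem rpow_mul_wvar_le_expectedVar (hμ : μ ∈ stdSimplex ℝ (Config V)) (hη : 0 ≤ η)
    (hSI : ∀ t ∈ Set.Ioo (0 : ℝ) 1, SpectrallyIndependent (magnetize μ fun _ => t) η)
    (f : Config V → ℝ) {θ : ℝ} (hθ : θ ∈ Set.Ioo (0 : ℝ) 1) :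
    θ ^ (1 + η) * wvar μ f ≤ expectedVar μ f θ := by
  have hone : expectedVar μ f 1 = wvar μ f := by
    rw [expectedVar, Finset.sum_eq_single ∅]
    · simp [plusWeight_one_empty]
    · intro R _ hR
      rw [sub_self, zero_pow (Finset.card_ne_zero.mpr (Finset.nonempty_iff_ne_empty.mpr hR)),
        zero_mul]
    · simp
  have hder : ∀ t : ℝ, 0 < t → HasDerivAt (fun t => expectedVar μ f t * t ^ (-(1 + η)))
      ((∑ R : Finset V, (1 - t) ^ R.card * ∑ v ∈ Rᶜ, revealTerm μ f t R v) * t ^ (-(1 + η)) +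
        expectedVar μ f t * (-(1 + η) * t ^ (-(1 + η) - 1))) t := fun t ht =>
    (hasDerivAt_expectedVar hμ.1 f ht).fun_mul (Real.hasDerivAt_rpow_const (Or.inl ht.ne'))
  -- Grönwall: `t E' ≤ (1 + η) E` says that `E(t) t ^ (-(1 + η))` does not increase.
  have hanti : AntitoneOn (fun t => expectedVar μ f t * t ^ (-(1 + η))) (Set.Icc θ 1) := by
    refine antitoneOn_of_deriv_nonpos (convex_Icc θ 1) ?_ ?_ ?_
    · exact fun t ht =>
        (hder t (hθ.1.trans_le ht.1)).continuousAt.continuousWithinAt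
    · intro t ht
      rw [interior_Icc] at ht
      exact (hder t (hθ.1.trans ht.1)).differentiableAt.differentiableWithinAt
    · intro t ht
      rw [interior_Icc] at ht
      have ht0 : 0 < t := hθ.1.trans ht.1
      rw [(hder t ht0).deriv]
      have hbound : t * ∑ R : Finset V, (1 - t) ^ R.card * ∑ v ∈ Rᶜ, revealTerm μ f t R v ≤
          (1 + η) * expectedVar μ f t := by
        rw [expectedVar, Finset.mul_sum, Finset.mul_sum]
        refine Finset.sum_le_sum fun R _ => ?_
        have h1 := sum_revealTerm_le hμ hη ht0 (hSI t ⟨ht0, ht.2⟩) f R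
        have h2 : 0 ≤ (1 - t) ^ R.card := pow_nonneg (by linarith [ht.2]) _
        nlinarith [mul_le_mul_of_nonneg_left h1 h2]
      have hsplit : t ^ (-(1 + η)) = t * t ^ (-(1 + η) - 1) := by
        rw [Real.rpow_sub_one ht0.ne']
        field_simp
      have hpos : 0 ≤ t ^ (-(1 + η) - 1) := Real.rpow_nonneg ht0.le _
      rw [hsplit]
      nlinarith [mul_le_mul_of_nonneg_right hbound hpos]
  have h := hanti ⟨le_rfl, hθ.2.le⟩ ⟨hθ.2.le, le_rfl⟩ hθ.2.le
  simp only [Real.one_rpow, mul_one, hone] at h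
  rw [Real.rpow_neg hθ.1.le] at h
  have hpos : 0 < θ ^ (1 + η) := Real.rpow_pos_of_pos hθ.1 _
  calc θ ^ (1 + η) * wvar μ f ≤ θ ^ (1 + η) * (expectedVar μ f θ * (θ ^ (1 + η))⁻¹) := by gcongr
    _ = _ := by field_simp

/-- Expected conditional variance is controlled by the Dirichlet form of the Glauber dynamics. -/
theorem minGapGD_mul_expectedVar_le (hμ : μ ∈ stdSimplex ℝ (Config V)) (f : Config V → ℝ) {θ : ℝ}
    (hθ : θ ∈ Set.Ioo (0 : ℝ) 1) :
    minGapGD (magnetize μ fun _ => θ) * expectedVar μ f θ ≤ dform μ f := by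
  have hm := magnetize_mem_stdSimplex hμ hθ.1
  have h1θ : 0 ≤ 1 - θ := by linarith [hθ.2]
  have hR : ∀ R, minGapGD (magnetize μ fun _ => θ) * wvar (plusWeight μ θ R) f ≤
      dform (plusWeight μ θ R) f := by
    intro R
    by_cases hZ : plusSum μ (fun _ => 1) θ R = 0
    · have h0 : plusWeight μ θ R = fun _ => 0 :=
        funext (plusWeight_eq_zero hμ.1 hθ.1 hZ (Finset.Subset.refl R) θ)
      simp [h0, wvar, dform]
    · have hs := one_mem_supp_marginal_magnetize hμ hθ.1 hZ
      have hν := pinned_mem_stdSimplex hm.1 hs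
      have hZ0 : 0 ≤ plusSum μ (fun _ => 1) θ R := by
        rw [plusSum_one_eq]
        exact Finset.sum_nonneg fun σ _ => plusWeight_nonneg hμ.1 hθ.1.le R σ
      rw [plusWeight_eq_mul_pinned hμ hθ.1 hZ, wvar_smul, dform_smul, mul_left_comm]
      refine mul_le_mul_of_nonneg_left ?_ hZ0
      exact (mul_le_mul_of_nonneg_right (minGapGD_le _ hs) (wvar_nonneg hν.1 f)).trans
        (gapGD_mul_wvar_le hν f)
  calc minGapGD (magnetize μ fun _ => θ) * expectedVar μ f θ
      = ∑ R : Finset V, (1 - θ) ^ R.card *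
          (minGapGD (magnetize μ fun _ => θ) * wvar (plusWeight μ θ R) f) := by
        rw [expectedVar, Finset.mul_sum]
        exact Finset.sum_congr rfl fun R _ => by ring
    _ ≤ ∑ R : Finset V, (1 - θ) ^ R.card * dform (plusWeight μ θ R) f :=
        Finset.sum_le_sum fun R _ => mul_le_mul_of_nonneg_left (hR R) (pow_nonneg h1θ _)
    _ = ∑ R : Finset V, dform (fun σ => (1 - θ) ^ R.card * plusWeight μ θ R σ) f :=
        Finset.sum_congr rfl fun R _ => (dform_smul _ _ _).symm
    _ ≤ dform (fun σ => ∑ R : Finset V, (1 - θ) ^ R.card * plusWeight μ θ R σ) f :=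
        sum_dform_le _ _ (fun R σ => mul_nonneg (pow_nonneg h1θ _)
          (plusWeight_nonneg hμ.1 hθ.1.le R σ)) f
    _ = dform μ f := by simp only [sum_pow_mul_plusWeight]

end Flow

end SpinDistribution

theorem theorem1p4 {V : Type*} [Fintype V] [DecidableEq V]
    (μ : SpinDistribution.Config V → ℝ) (hμ : μ ∈ stdSimplex ℝ (SpinDistribution.Config V))
    (η : ℝ) (hη : 0 < η) (hSI : SpinDistribution.CompletelySpectrallyIndependent μ η)
    (θ : ℝ) (hθ : θ ∈ Set.Ioo (0 : ℝ) 1) :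
    SpinDistribution.gapGD μ ≥
      (θ / 2) ^ (2 * η + 7) *
        SpinDistribution.minGapGD (SpinDistribution.magnetize μ (fun _ => θ)) := by
  have hm := SpinDistribution.magnetize_mem_stdSimplex hμ hθ.1
  have hgap0 := SpinDistribution.minGapGD_nonneg hm.1
  have hgap1 := SpinDistribution.minGapGD_le_one hm
  -- The stated constant is weaker: both halving the base and raising the exponent decrease the
  -- power.
  have hpow : (θ / 2) ^ (2 * η + 7) ≤ θ ^ (1 + η) := by
    calc (θ / 2) ^ (2 * η + 7) ≤ θ ^ (2 * η + 7) :=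
          Real.rpow_le_rpow (by linarith [hθ.1]) (by linarith [hθ.1]) (by linarith)
      _ ≤ θ ^ (1 + η) := Real.rpow_le_rpow_of_exponent_ge hθ.1 hθ.2.le (by linarith)
  have hpow0 : 0 ≤ θ ^ (1 + η) := Real.rpow_nonneg hθ.1.le _
  have hpow1 : θ ^ (1 + η) ≤ 1 := Real.rpow_le_one hθ.1.le hθ.2.le (by linarith)
  refine (mul_le_mul_of_nonneg_right hpow hgap0).trans ?_
  refine SpinDistribution.le_gapGD_of_poincare hμ (mul_le_one₀ hpow1 hgap0 hgap1) fun f => ?_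
  have h1 := SpinDistribution.rpow_mul_wvar_le_expectedVar hμ hη.le
    (fun t ht => hSI (fun _ => t) fun _ => ⟨ht.1, ht.2.le⟩) f hθ
  calc _ = SpinDistribution.minGapGD (SpinDistribution.magnetize μ fun _ => θ) *
        (θ ^ (1 + η) * SpinDistribution.wvar μ f) := by ring
    _ ≤ _ := mul_le_mul_of_nonneg_left h1 hgap0
    _ ≤ _ := SpinDistribution.minGapGD_mul_expectedVar_le hμ f hθ
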